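/- **Conventions.** An $f$-algebra is a commutative unital real algebra $U$ with a Riesz space (vector lattice) order such that products of non-negative elements are non-negative and $u\wedge v=0$, $w\ge 0$ imply $(uw)\wedge v=0$; its simple elements are the finite sums $\sum_i\lambda_i u_i$ with $\lambda_i\in\mathbb R$ and $(u_i)$ finitely many pairwise disjoint idempotents with sum $1$. A countable partition of $1$ is a sequence $(u_n)_{n\in\mathbb N}$ of pairwise disjoint idempotents with $\sup_n u_n=1$. An $f$-algebra is localisable if it is Dedekind $\sigma$-complete, its multiplication is $\sigma$-order-continuous on $U^+\times U^+$, and each $u\ge 0$ is the supremum of a non-decreasing sequence of non-negative simple elements. A metric Riesz space is a Dedekind $\sigma$-complete Riesz space with a complete translation-invariant distance $\mathsf d$ such that $\mathsf d(u,0)=\mathsf d(|u|,0)$ and $\mathsf d(\cdot,0)$ is order-preserving on the positive cone. A metric $f$-algebra is a localisable $f$-algebra that is a metric Riesz space with continuous multiplication, dense simple elements, and $\mathsf d(\varepsilon 1,0)\to0$ as $\varepsilon\searrow0$. A metric $f$-structure $(\mathcal U,U,V)$ consists of a localisable $f$-algebra $\mathcal U$, a metric $f$-algebra $U$ that is a solid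 $f$-subalgebra of $\mathcal U$, and a metric Riesz space $V$ that is a solid Riesz subspace of $\mathcal U$, such that $UV=V$, the multiplication $U\times V\to V$ is continuous, and for every countable partition $(u_n)$ of $1$ in $U$ and every $\varepsilon>0$ there is $\delta>0$ such that $(v_n)\subset V^+$ and $\sum_n\mathsf d_V(u_nv_n,0)\le\delta$ imply that $(u_nv_n)$ is order-bounded in $V$ and $\mathsf d_V(\sup_nu_nv_n,0)\le\varepsilon$. A homomorphism $\phi:(\mathcal U_1,U_1,V_1)\to(\mathcal U_2,U_2,V_2)$ is a homomorphism of $f$-algebras $\phi:\mathcal U_1\to\mathcal U_2$ (linear, unital, multiplicative, and $u\wedge v=0$ implies $\phi(u)\wedge\phi(v)=0$) with $\phi(U_1)\subset U_2$, $\phi(V_1)\subset V_2$, whose restriction $U_1\to U_2$ is Lipschitz and $\sigma$-order-continuous and whose restriction $V_1\to V_2$ is Lipschitz. A $V$-normed $U$-module is a $U$-module $\mathscr M$ with a map $|\cdot|:\mathscr M\to V^+$ such that $|v|=0\iff v=0$, $|v+w|\le|v|+|w|$, $|u\cdot v|=|u||v|$, and with the glueing property: if $(u_n)$ is a countable partition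 of $1$ in $U$ and $(v_n)\subset\mathscr M$ is such that $(|u_n\cdot v_n|)_n$ is order-bounded in $V$, then there is $v\in\mathscr M$ with $u_n\cdot v=u_n\cdot v_n$ for all $n$. For $S\subset\mathscr M$, $\mathscr G(S)$ is the set of all such $v$ obtained with $(v_n)\subset S$. $\mathscr M$ is a real vector space through $\lambda v=(\lambda 1)\cdot v$, and is a $V$-Banach $U$-module if the distance $\mathsf d_V(|v-w|,0)$ is complete. $\mathrm{Hom}(\mathscr M,\mathscr N)$ is the set of $U$-linear $T:\mathscr M\to\mathscr N$ for which some $b\in U^+$ satisfies $|Tv|\le b|v|$ for all $v$; when $U$ is Dedekind complete, $|T|$ is the infimum of these $b$. The category $\mathbf{BanMod}_{(\mathcal U,U,V)}$ has the $V$-Banach $U$-modules as objects and the $T\in\mathrm{Hom}(\mathscr M,\mathscr N)$ with $|Tv|\le|v|$ for all $v$ as morphisms; its isomorphisms are the bijective $U$-linear maps preserving $|\cdot|$. **Theorem.** Let $\phi:(\mathcal U_1,U_1,V_1)\to(\mathcal U_2,U_2,V_2)$ be a homomorphism of metric $f$-structures. 1. For every $V_1$-normed $U_1$-module $\mathscr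 M$ there is a couple $(\phi_*\mathscr M,\phi_*)$, where $\phi_*\mathscr M$ is a $V_2$-Banach $U_2$-module and $\phi_*:\mathscr M\to\phi_*\mathscr M$ is linear, such that (i) $|\phi_*v|=\phi(|v|)$ for every $v\in\mathscr M$, and (ii) $\mathscr G(\phi_*(\mathscr M))$ is dense in $\phi_*\mathscr M$. It is unique up to unique isomorphism: for any other couple $(\mathscr N,T)$ with these properties there is a unique isomorphism of $V_2$-Banach $U_2$-modules $\Phi:\phi_*\mathscr M\to\mathscr N$ with $\Phi\circ\phi_*=T$. 2. Let $\mathscr M,\mathscr N$ be $V_1$-normed $U_1$-modules and $T\in\mathrm{Hom}(\mathscr M,\mathscr N)$. Then there is a unique $\phi_*T\in\mathrm{Hom}(\phi_*\mathscr M,\phi_*\mathscr N)$ with $\phi_*T\circ\phi_*=\phi_*\circ T$. If moreover $U_1$ and $U_2$ are Dedekind complete, then $|\phi_*T|\le\phi(|T|)$. 3. These constructions give a functor $\phi_*:\mathbf{BanMod}_{(\mathcal U_1,U_1,V_1)}\to\mathbf{BanMod}_{(\mathcal U_2,U_2,V_2)}$: there is a functor sending each $\mathscr M$ to a module $\phi_*\mathscr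 M$ as in 1 and each morphism $T$ to the homomorphism $\phi_*T$ of 2. -/

import Mathlib

open Set Filter Topology CategoryTheory
open scoped Pointwise

universe u u₁ u₂ w w' w''

namespace FMod

/-! ### Order notions -/

/-- Countable non-empty subsets that are bounded above (below) have a supremum (an infimum). -/
def DedekindSigmaComplete (P : Type*) [Preorder P] : Prop :=
  (∀ s : Set P, s.Countable → s.Nonempty → BddAbove s → ∃ a, IsLUB s a) ∧
  (∀ s : Set P, s.Countable → s.Nonempty → BddBelow s → ∃ a, IsGLB s a)

/-- Non-empty subsets that are bounded above (below) have a supremum (an infimum). -/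
def DedekindComplete (P : Type*) [Preorder P] : Prop :=
  (∀ s : Set P, s.Nonempty → BddAbove s → ∃ a, IsLUB s a) ∧
  (∀ s : Set P, s.Nonempty → BddBelow s → ∃ a, IsGLB s a)

def OrderBounded {P : Type*} [Preorder P] (s : Set P) : Prop :=
  BddAbove s ∧ BddBelow s

/-- Order-preserving maps that preserve the existing suprema of non-decreasing sequences and the
existing infima of non-increasing sequences. -/
def SigmaOrderContinuous {P Q : Type*} [Preorder P] [Preorder Q] (f : P → Q) : Prop :=
  Monotone f ∧
  (∀ (p : ℕ → P) (a : P), Monotone p → IsLUB (range p) a → IsLUB (range fun n => f (p n)) (f a)) ∧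
  (∀ (p : ℕ → P) (a : P), Antitone p → IsGLB (range p) a → IsGLB (range fun n => f (p n)) (f a))

/-! ### Riesz spaces and `f`-algebras -/

/-- A Riesz space: a real vector space with a compatible lattice order. -/
class RieszSpace (E : Type*) [AddCommGroup E] [Module ℝ E] [Lattice E] : Prop
    extends IsOrderedAddMonoid E where
  smul_nonneg' : ∀ (r : ℝ) (x : E), 0 ≤ r → 0 ≤ x → 0 ≤ r • x

/-- A (commutative, unital) `f`-algebra. -/
class FAlgebra (A : Type*) [CommRing A] [Algebra ℝ A] [Lattice A] : Prop
    extends RieszSpace A where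
  mul_nonneg' : ∀ x y : A, 0 ≤ x → 0 ≤ y → 0 ≤ x * y
  mul_inf_eq_zero : ∀ x y z : A, x ⊓ y = 0 → 0 ≤ z → (x * z) ⊓ y = 0

/-- `u` is a countable partition of `e`: pairwise disjoint idempotents with supremum `e`. -/
structure IsCountablePartition {A : Type*} [CommRing A] [Lattice A] (x : ℕ → A) (e : A) :
    Prop where
  idem : ∀ n, IsIdempotentElem (x n)
  disjoint : ∀ n m, n ≠ m → |x n| ⊓ |x m| = 0
  isLUB : IsLUB (range x) e

/-- A finite partition of `e`: pairwise disjoint idempotents with sum `e`. -/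
structure IsFinitePartition {A : Type*} [CommRing A] [Lattice A] {k : ℕ} (x : Fin k → A) (e : A) :
    Prop where
  idem : ∀ i, IsIdempotentElem (x i)
  disjoint : ∀ i j, i ≠ j → |x i| ⊓ |x j| = 0
  sum_eq : ∑ i, x i = e

/-- The simple elements of an `f`-algebra. -/
def simpleElements (A : Type*) [CommRing A] [Algebra ℝ A] [Lattice A] : Set A :=
  {a | ∃ (k : ℕ) (r : Fin k → ℝ) (x : Fin k → A), IsFinitePartition x 1 ∧ a = ∑ i, r i • x i}

/-- A localisable `f`-algebra. -/
class LocalisableFAlgebra (A : Type*) [CommRing A] [Algebra ℝ A] [Lattice A] : Prop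
    extends FAlgebra A where
  sigmaComplete : DedekindSigmaComplete A
  mul_sigmaOrderContinuous :
    SigmaOrderContinuous (fun p : Ici (0 : A) × Ici (0 : A) => (p.1 : A) * (p.2 : A))
  simple_superOrderDense : ∀ a : A, 0 ≤ a → ∃ s : ℕ → A,
    (∀ n, s n ∈ simpleElements A ∧ 0 ≤ s n) ∧ Monotone s ∧ IsLUB (range s) a

/-- A metric Riesz space. -/
class MetricRieszSpace (E : Type*) [AddCommGroup E] [Module ℝ E] [Lattice E] [MetricSpace E] : Prop
    extends RieszSpace E where
  sigmaComplete' : DedekindSigmaComplete E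
  complete : CompleteSpace E
  dist_abs_zero : ∀ x : E, dist x 0 = dist |x| 0
  dist_add_right_eq : ∀ x y z : E, dist x y = dist (x + z) (y + z)
  dist_zero_mono : ∀ x y : E, 0 ≤ x → x ≤ y → dist x 0 ≤ dist y 0

/-- A metric `f`-algebra. -/
class MetricFAlgebra (A : Type*) [CommRing A] [Algebra ℝ A] [Lattice A] [MetricSpace A] : Prop
    extends LocalisableFAlgebra A, MetricRieszSpace A where
  continuous_mul' : Continuous (fun p : A × A => p.1 * p.2)
  dense_simple : Dense (simpleElements A)
  tendsto_smul_one : Tendsto (fun ε : ℝ => dist (ε • (1 : A)) 0) (𝓝[>] 0) (𝓝 0)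

/-! ### Homomorphisms -/

/-- A linear map is a homomorphism of Riesz spaces if it preserves disjointness of positive
elements. -/
def IsRieszHom {E F : Type*} [AddCommGroup E] [Module ℝ E] [Lattice E]
    [AddCommGroup F] [Module ℝ F] [Lattice F] (f : E →ₗ[ℝ] F) : Prop :=
  ∀ x y : E, x ⊓ y = 0 → f x ⊓ f y = 0

/-- Homomorphisms of metric Riesz spaces. -/
def IsMetricRieszHom {E F : Type*} [AddCommGroup E] [Module ℝ E] [Lattice E] [MetricSpace E]
    [AddCommGroup F] [Module ℝ F] [Lattice F] [MetricSpace F] (f : E →ₗ[ℝ] F) : Prop :=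
  IsRieszHom f ∧ ∃ K, LipschitzWith K f

/-- Homomorphisms of metric `f`-algebras: Lipschitz, `σ`-order-continuous, unital multiplicative
homomorphisms of Riesz spaces. -/
def IsMetricFAlgebraHom {A B : Type*} [CommRing A] [Algebra ℝ A] [Lattice A] [MetricSpace A]
    [CommRing B] [Algebra ℝ B] [Lattice B] [MetricSpace B] (f : A →ₐ[ℝ] B) : Prop :=
  IsRieszHom f.toLinearMap ∧ SigmaOrderContinuous f ∧ ∃ K, LipschitzWith K f

/-! ### Subspaces and metric `f`-structures -/

section Structures

variable {A : Type u} [CommRing A] [Algebra ℝ A] [Lattice A]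

variable (A) in
/-- An `f`-subalgebra: a unital subalgebra which is a sublattice. -/
structure FSubalgebra extends Subalgebra ℝ A where
  sup_mem : ∀ x y, x ∈ toSubalgebra → y ∈ toSubalgebra → x ⊔ y ∈ toSubalgebra
  inf_mem : ∀ x y, x ∈ toSubalgebra → y ∈ toSubalgebra → x ⊓ y ∈ toSubalgebra

variable (A) in
/-- A Riesz subspace: a linear subspace which is a sublattice. -/
structure RieszSubspace extends Submodule ℝ A where
  sup_mem : ∀ x y, x ∈ toSubmodule → y ∈ toSubmodule → x ⊔ y ∈ toSubmodule
  inf_mem : ∀ x y, x ∈ toSubmodule → y ∈ toSubmodule → x ⊓ y ∈ toSubmodule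

instance : CoeSort (FSubalgebra A) (Type u) := ⟨fun U => U.toSubalgebra⟩

instance : CoeSort (RieszSubspace A) (Type u) := ⟨fun V => V.toSubmodule⟩

instance (U : FSubalgebra A) : Lattice U :=
  Subtype.lattice (fun x y hx hy => U.sup_mem x y hx hy) (fun x y hx hy => U.inf_mem x y hx hy)

instance (V : RieszSubspace A) : Lattice V :=
  Subtype.lattice (fun x y hx hy => V.sup_mem x y hx hy) (fun x y hx hy => V.inf_mem x y hx hy)

variable (A) in
/-- The data underlying a metric `f`-structure with ambient `f`-algebra `A`: an `f`-subalgebra `U`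
and a Riesz subspace `V` with `U V = V`, each with its own distance. -/
structure FTriple where
  U : FSubalgebra A
  V : RieszSubspace A
  metricU : MetricSpace U
  metricV : MetricSpace V
  mul_eq : (U.toSubalgebra : Set A) * (V.toSubmodule : Set A) = (V.toSubmodule : Set A)

attribute [instance] FTriple.metricU FTriple.metricV

/-- The multiplication of the ambient algebra, as a map `U × V → V`. -/
instance (S : FTriple A) : SMul S.U S.V :=
  ⟨fun x v => ⟨(x : A) * (v : A), by
    have h : (x : A) * (v : A) ∈
        (S.U.toSubalgebra : Set A) * (S.V.toSubmodule : Set A) := mul_mem_mul x.2 v.2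
    rw [S.mul_eq] at h
    exact h⟩⟩

theorem FTriple.coe_smul (S : FTriple A) (x : S.U) (v : S.V) :
    ((x • v : S.V) : A) = (x : A) * (v : A) := rfl

/-- The conditions making the triple `(A, U, V)` a metric `f`-structure. -/
structure IsMetricFStructure (S : FTriple A) : Prop where
  localisable : LocalisableFAlgebra A
  metricFAlgebra : MetricFAlgebra S.U
  solidU : ∀ x y : A, y ∈ S.U.toSubalgebra → |x| ≤ |y| → x ∈ S.U.toSubalgebra
  metricRiesz : MetricRieszSpace S.V
  solidV : ∀ x y : A, y ∈ S.V.toSubmodule → |x| ≤ |y| → x ∈ S.V.toSubmodule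
  continuous_smul' : Continuous (fun p : S.U × S.V => p.1 • p.2)
  glue_bound : ∀ x : ℕ → S.U, IsCountablePartition x 1 → ∀ ε : ℝ, 0 < ε → ∃ δ : ℝ, 0 < δ ∧
    ∀ v : ℕ → S.V, (∀ n, 0 ≤ v n) →
      Summable (fun n => dist (x n • v n) 0) → ∑' n, dist (x n • v n) 0 ≤ δ →
      OrderBounded (range fun n => x n • v n) ∧
      ∀ b : S.V, IsLUB (range fun n => x n • v n) b → dist b 0 ≤ ε

variable (A) in
/-- A metric `f`-structure with ambient algebra `A`. -/
structure MetricFStructure extends FTriple A where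
  isMetric : IsMetricFStructure toFTriple

instance (S : MetricFStructure A) : MetricFAlgebra S.U := S.isMetric.metricFAlgebra

instance (S : MetricFStructure A) : MetricRieszSpace S.V := S.isMetric.metricRiesz

/-- A homomorphism of metric `f`-structures. -/
structure MetricFStructureHom {A : Type u₁} [CommRing A] [Algebra ℝ A] [Lattice A]
    {B : Type u₂} [CommRing B] [Algebra ℝ B] [Lattice B]
    (S₁ : MetricFStructure A) (S₂ : MetricFStructure B) where
  toAlgHom : A →ₐ[ℝ] B
  isRieszHom : IsRieszHom toAlgHom.toLinearMap
  map_U : ∀ x ∈ S₁.U.toSubalgebra, toAlgHom x ∈ S₂.U.toSubalgebra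
  map_V : ∀ x ∈ S₁.V.toSubmodule, toAlgHom x ∈ S₂.V.toSubmodule
  isHom_U : IsMetricFAlgebraHom
    ((toAlgHom.comp S₁.U.toSubalgebra.val).codRestrict S₂.U.toSubalgebra
      (fun x => map_U x.1 x.2) : S₁.U →ₐ[ℝ] S₂.U)
  isHom_V : IsMetricRieszHom
    (toAlgHom.toLinearMap.restrict map_V : S₁.V →ₗ[ℝ] S₂.V)

namespace MetricFStructureHom

variable {A : Type u₁} [CommRing A] [Algebra ℝ A] [Lattice A]
  {B : Type u₂} [CommRing B] [Algebra ℝ B] [Lattice B]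
  {S₁ : MetricFStructure A} {S₂ : MetricFStructure B}

/-- The restriction `U₁ → U₂`. -/
def onU (φ : MetricFStructureHom S₁ S₂) (x : S₁.U) : S₂.U :=
  ⟨φ.toAlgHom x, φ.map_U x.1 x.2⟩

/-- The restriction `V₁ → V₂`. -/
def onV (φ : MetricFStructureHom S₁ S₂) (v : S₁.V) : S₂.V :=
  ⟨φ.toAlgHom v, φ.map_V v.1 v.2⟩

end MetricFStructureHom

/-! ### Normed modules -/

/-- A `V`-normed `U`-module. -/
structure NormMod (S : MetricFStructure A) where
  carrier : Type w
  [addCommGroup : AddCommGroup carrier]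
  [module : Module S.U carrier]
  /-- the pointwise norm -/
  pnorm : carrier → S.V
  pnorm_nonneg : ∀ v, 0 ≤ pnorm v
  pnorm_eq_zero : ∀ v, pnorm v = 0 ↔ v = 0
  pnorm_add_le : ∀ v v', pnorm (v + v') ≤ pnorm v + pnorm v'
  pnorm_smul : ∀ (x : S.U) (v : carrier), pnorm (x • v) = |x| • pnorm v
  glueing : ∀ x : ℕ → S.U, IsCountablePartition x 1 → ∀ v : ℕ → carrier,
    OrderBounded (range fun n => pnorm (x n • v n)) → ∃ z : carrier, ∀ n, x n • z = x n • v n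

namespace NormMod

variable {S : MetricFStructure A}

instance : CoeSort (NormMod.{u, w} S) (Type w) := ⟨NormMod.carrier⟩

attribute [instance] NormMod.addCommGroup NormMod.module

/-- The real vector space structure: `r • v = (r 1_U) • v`. -/
instance (M : NormMod.{u, w} S) : Module ℝ M := Module.compHom M (algebraMap ℝ S.U)

theorem pnorm_neg (M : NormMod.{u, w} S) (v : M) : M.pnorm (-v) = M.pnorm v := by
  have h1 := M.pnorm_smul (-1) v
  have h2 := M.pnorm_smul 1 v
  rw [neg_one_smul, abs_neg] at h1
  rw [one_smul] at h2
  rw [h1, ← h2]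

/-- The distance `d_M(v, v') = d_V(|v - v'|, 0)`. -/
instance metricSpace (M : NormMod.{u, w} S) : MetricSpace M where
  dist v v' := dist (M.pnorm (v - v')) 0
  dist_self v := by
    rw [sub_self, (M.pnorm_eq_zero 0).2 rfl, dist_self]
  dist_comm v v' := by
    rw [← M.pnorm_neg, neg_sub]
  dist_triangle v v' v'' := by
    have h1 : M.pnorm (v - v'') ≤ M.pnorm (v - v') + M.pnorm (v' - v'') := by
      have := M.pnorm_add_le (v - v') (v' - v'')
      rwa [sub_add_sub_cancel] at this
    have h2 : dist (M.pnorm (v - v') + M.pnorm (v' - v'')) 0 ≤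
        dist (M.pnorm (v - v') + M.pnorm (v' - v'')) (0 + M.pnorm (v' - v'')) +
          dist (0 + M.pnorm (v' - v'')) 0 := dist_triangle _ _ _
    rw [← MetricRieszSpace.dist_add_right_eq, zero_add] at h2
    exact (MetricRieszSpace.dist_zero_mono _ _ (M.pnorm_nonneg _) h1).trans h2
  eq_of_dist_eq_zero {v v'} h := by
    change dist (M.pnorm (v - v')) 0 = 0 at h
    exact sub_eq_zero.1 ((M.pnorm_eq_zero _).1 (dist_eq_zero.1 h))

/-- The set `𝒢(s)` of all elements obtained by glueing together elements of `s`. -/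
def glue (M : NormMod.{u, w} S) (s : Set M) : Set M :=
  {z | ∃ (x : ℕ → S.U) (v : ℕ → M), IsCountablePartition x 1 ∧ (∀ n, v n ∈ s) ∧
    OrderBounded (range fun n => M.pnorm (x n • v n)) ∧ ∀ n, x n • z = x n • v n}

/-- The elements `b ∈ U⁺` with `|T v| ≤ b |v|` for all `v`. -/
def bounds {M : NormMod.{u, w} S} {N : NormMod.{u, w'} S} (T : M →ₗ[S.U] N) : Set S.U :=
  {b | 0 ≤ b ∧ ∀ v : M, N.pnorm (T v) ≤ b • M.pnorm v}

/-- The homomorphisms of normed modules, `Hom(M, N)`. -/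
def homs (M : NormMod.{u, w} S) (N : NormMod.{u, w'} S) : Set (M →ₗ[S.U] N) :=
  {T | (bounds T).Nonempty}

theorem mem_homs_of_le {M : NormMod.{u, w} S} {N : NormMod.{u, w'} S} (T : M →ₗ[S.U] N)
    (h : ∀ v : M, N.pnorm (T v) ≤ M.pnorm v) : T ∈ homs M N := by
  refine ⟨|1|, ?_, fun v => ?_⟩
  · have : (0 : S.U) ≤ |1| := abs_nonneg _
    exact this
  · rw [← M.pnorm_smul, one_smul]
    exact h v

/-- Morphisms of the category of normed modules: the `T ∈ Hom(M, N)` with `|T v| ≤ |v|`. -/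
@[ext]
structure Mor (M : NormMod.{u, w} S) (N : NormMod.{u, w'} S) where
  toLin : M →ₗ[S.U] N
  mem_homs : toLin ∈ homs M N
  pnorm_le : ∀ v : M, N.pnorm (toLin v) ≤ M.pnorm v

/-- The category of normed modules over `S`. -/
instance : Category (NormMod.{u, w} S) where
  Hom M N := Mor M N
  id M := ⟨LinearMap.id, mem_homs_of_le _ fun _ => le_rfl, fun _ => le_rfl⟩
  comp T T' := ⟨T'.toLin.comp T.toLin,
    mem_homs_of_le _ fun v => (T'.pnorm_le (T.toLin v)).trans (T.pnorm_le v),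
    fun v => (T'.pnorm_le (T.toLin v)).trans (T.pnorm_le v)⟩

end NormMod

/-- The normed modules that are complete. -/
def isBanach (S : MetricFStructure A) : ObjectProperty (NormMod.{u, w} S) :=
  fun M => CompleteSpace M

/-- The category of `V`-Banach `U`-modules: a full subcategory of the normed modules. -/
abbrev BanMod (S : MetricFStructure A) := (isBanach.{u, w} S).FullSubcategory

end Structures

/-- The couple `(P, p)` is a pushforward of the normed module `M` under `φ`: `P` is a Banach module
over the target, `|p v| = φ(|v|)`, and the glueings of the image of `p` are dense. -/
structure IsPushforward {A : Type u₁} [CommRing A] [Algebra ℝ A] [Lattice A]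
    {B : Type u₂} [CommRing B] [Algebra ℝ B] [Lattice B]
    {S₁ : MetricFStructure A} {S₂ : MetricFStructure B} (φ : MetricFStructureHom S₁ S₂)
    (M : NormMod.{u₁, w} S₁) (P : BanMod.{u₂, w'} S₂) (p : M →ₗ[ℝ] P.obj) : Prop where
  pnorm_eq : ∀ v : M, P.obj.pnorm (p v) = φ.onV (M.pnorm v)
  dense : Dense (P.obj.glue (range p))

end FMod

open FMod

namespace FMod

/-! ### Elementary facts on `f`-algebras -/

section FAlg

variable {A : Type*} [CommRing A] [Algebra ℝ A] [Lattice A] [FAlgebra A]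

/-! Since `φ` is positive, `v ↦ φ(|v|)` is a `V₂`-valued seminorm on the real vector space `M`. The
pushforward is the complete `U₂`-module generated by it. Take functions with values in `M` that are
constant on the pieces of a countable partition of `1` in `U₂`, let step elements (real multiples of
each piece) act on them, and complete. Step elements are dense in `U₂`, so the action extends by
continuity to all of `U₂`. Glueing survives the completion (`Compl.glueing`) because of the axiom on
partitions: pieces approximated with summable errors have errors whose supremum is small.

No quotient is formed by hand. A locally constant function is an honest function on `S.U`,
prescribed at the non-zero elements below each piece. Zero lies below every piece, so the value
there is left free. Sums are then pointwise, and the completion identifies functions at distance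
zero. A step scalar is likewise a pair: an element of `U₂` and a function giving its local values.

The universal property is `NormMod.exists_extension`. The pairs glued from `(p v, t v)` have a
closure that is a `U`-submodule on which the second norm is at most `c` times the first; hence it is
the graph of a map. Uniqueness (`IsPushforward.hom_ext`) is density of glueings plus continuity. The
isomorphism between pushforwards, the map `φ_* T` and functoriality all follow from these two facts.

For `|φ_* T| ≤ φ(|T|)`, the infimum of the bounds of `T` must itself be a bound
(`isGLB_mem_bounds`). This rests on order continuity of multiplication by a fixed positive element
(`nonpos_of_forall_le_mul`). -/

theorem mul_eq_zero_of_inf_eq_zero {x y : A} (h : x ⊓ y = 0) : x * y = 0 := by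
  have hx : 0 ≤ x := h ▸ inf_le_left
  have hy : 0 ≤ y := h ▸ inf_le_right
  have h1 := FAlgebra.mul_inf_eq_zero x y y h hy
  rw [inf_comm] at h1
  have h2 := FAlgebra.mul_inf_eq_zero y (x * y) x h1 hx
  rwa [mul_comm y x, inf_idem] at h2

/-- Multiplication by `z ≥ 0` keeps `x⁺` and `x⁻` disjoint, and the supremum of two disjoint
elements is their sum. -/
theorem posPart_mul {x z : A} (hz : 0 ≤ z) : (z * x)⁺ = z * x⁺ := by
  have h1 := FAlgebra.mul_inf_eq_zero _ _ _ (posPart_inf_negPart_eq_zero x) hz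
  rw [inf_comm] at h1
  have h2 := FAlgebra.mul_inf_eq_zero _ _ _ h1 hz
  have h3 : z * x = z * x⁺ - z * x⁻ := by rw [← mul_sub, posPart_sub_negPart]
  have h4 : (z * x⁺ - z * x⁻)⁺ = z * x⁺ ⊔ z * x⁻ - z * x⁻ := by
    rw [posPart_def, sup_sub, sub_self]
  have h5 := inf_add_sup (z * x⁺) (z * x⁻)
  rw [mul_comm z x⁺, mul_comm z x⁻, inf_comm, h2, zero_add] at h5
  rw [h3, h4, mul_comm z x⁺, mul_comm z x⁻, h5, add_sub_cancel_right]

theorem abs_mul_of_nonneg {x z : A} (hz : 0 ≤ z) : |z * x| = z * |x| := by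
  have h : ∀ y : A, |y| = y⁺ + y⁺ - y := fun y => by
    rw [← posPart_add_negPart y]
    nth_rw 5 [← posPart_sub_negPart y]
    abel
  rw [h, h, posPart_mul hz]
  ring

theorem mul_le_mul_left_of_nonneg {x y z : A} (hz : 0 ≤ z) (h : x ≤ y) : z * x ≤ z * y := by
  have := FAlgebra.mul_nonneg' z (y - x) hz (sub_nonneg.2 h)
  rwa [mul_sub, sub_nonneg] at this

theorem mul_self_nonneg' (x : A) : 0 ≤ x * x := by
  have h := mul_eq_zero_of_inf_eq_zero (posPart_inf_negPart_eq_zero x)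
  have h1 : x * x = x⁺ * x⁺ + x⁻ * x⁻ := by
    nth_rw 1 2 [← posPart_sub_negPart x]
    linear_combination (-2) * h
  rw [h1]
  exact add_nonneg (FAlgebra.mul_nonneg' _ _ (posPart_nonneg _) (posPart_nonneg _))
    (FAlgebra.mul_nonneg' _ _ (negPart_nonneg _) (negPart_nonneg _))

theorem idem_nonneg {x : A} (h : IsIdempotentElem x) : 0 ≤ x := by
  rw [← h.eq]; exact mul_self_nonneg' x

theorem idem_le_one {x : A} (h : IsIdempotentElem x) : x ≤ 1 :=
  sub_nonneg.1 (idem_nonneg h.one_sub)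

theorem one_nonneg' : (0 : A) ≤ 1 := idem_nonneg IsIdempotentElem.one

theorem algebraMap_nonneg {r : ℝ} (hr : 0 ≤ r) : 0 ≤ algebraMap ℝ A r := by
  rw [Algebra.algebraMap_eq_smul_one]
  exact RieszSpace.smul_nonneg' r 1 hr one_nonneg'

theorem abs_algebraMap (r : ℝ) : |algebraMap ℝ A r| = algebraMap ℝ A |r| := by
  rcases le_total 0 r with h | h
  · rw [abs_of_nonneg h, abs_of_nonneg (algebraMap_nonneg h)]
  · have h1 := algebraMap_nonneg (A := A) (neg_nonneg.2 h)
    rw [abs_of_nonpos h, ← abs_neg, ← map_neg, abs_of_nonneg h1]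

/-- In a Dedekind `σ`-complete `f`-algebra, `n c ≤ y` for all `n` forces `c ≤ 0`. -/
theorem nonpos_of_forall_nsmul_le (hA : DedekindSigmaComplete A) {c y : A}
    (h : ∀ n : ℕ, n • c ≤ y) : c ≤ 0 := by
  obtain ⟨s, hs⟩ := hA.1 (range fun n : ℕ => n • c) (countable_range _) (range_nonempty _)
    ⟨y, by rintro _ ⟨n, rfl⟩; exact h n⟩
  have h1 : s ≤ s - c := hs.2 (by
    rintro _ ⟨n, rfl⟩
    have := hs.1 ⟨n + 1, rfl⟩
    simp only [succ_nsmul] at this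
    exact le_sub_iff_add_le.2 this)
  have := le_sub_iff_add_le.1 h1
  exact (add_le_iff_nonpos_right s).1 this

/-- Multiplication by a positive element is order-continuous: if `c ≤ b w` for all `b ∈ D` and
every positive lower bound of `D` vanishes, then `c ≤ 0`. -/
theorem nonpos_of_forall_le_mul (hA : DedekindSigmaComplete A) {D : Set A} {c w : A}
    (hc0 : 0 ≤ c) (hw : 0 ≤ w) (hD0 : ∀ b ∈ D, 0 ≤ b)
    (hD : ∀ e : A, 0 ≤ e → (∀ b ∈ D, e ≤ b) → e = 0)
    (hc : ∀ b ∈ D, c ≤ b * w) : c ≤ 0 := by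
  -- `w` need not lie below a multiple of `1`, so it is truncated at `N = n 1`. With `x = (N - w)⁺`
  -- one has `x * w ≤ N * N`, so a positive multiple of `c * x` is a lower bound of `D` and
  -- vanishes. Then `c * (N - w) ≤ c * x = 0`, that is `n c ≤ c w`.
  refine nonpos_of_forall_nsmul_le hA (y := c * w) fun n => ?_
  set N : A := algebraMap ℝ A n with hN
  have hN0 : 0 ≤ N := algebraMap_nonneg (Nat.cast_nonneg n)
  have hNc : (n : A) = N := by rw [hN, map_natCast]
  set x : A := (N - w)⁺ with hx
  have hx0 : 0 ≤ x := posPart_nonneg _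
  have hxN : x ≤ N := sup_le (sub_le_self _ hw) hN0
  have h1 : x * w ≤ x * N := by
    have e : x * N - x * w = x * x := by
      have := mul_eq_zero_of_inf_eq_zero (posPart_inf_negPart_eq_zero (N - w))
      rw [← mul_sub]
      nth_rw 1 [← posPart_sub_negPart (N - w)]
      rw [mul_sub, hx, this, sub_zero]
    rw [← sub_nonneg, e]; exact mul_self_nonneg' x
  have h2 : x * w ≤ N * N := h1.trans (by
    rw [mul_comm x N]; exact mul_le_mul_left_of_nonneg hN0 hxN)
  have hcx0 : 0 ≤ c * x := FAlgebra.mul_nonneg' _ _ hc0 hx0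
  have h3 : c * x = 0 := by
    -- The `+ 1` keeps the constant invertible when `n = 0`.
    set m : ℝ := ((n : ℝ) * n + 1)⁻¹ with hm
    have hpos : (0 : ℝ) < (n : ℝ) * n + 1 := by positivity
    have hm0 : 0 ≤ algebraMap ℝ A m := algebraMap_nonneg (by positivity)
    have h4 : algebraMap ℝ A m * (c * x) = 0 := by
      refine hD _ (FAlgebra.mul_nonneg' _ _ hm0 hcx0) fun b hb => ?_
      have h5 : c * x ≤ b * (N * N + 1) := by
        have h6 : c * x ≤ b * w * x := by
          rw [mul_comm c, mul_comm (b * w)]; exact mul_le_mul_left_of_nonneg hx0 (hc b hb)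
        have h7 : b * (x * w) ≤ b * (N * N + 1) :=
          mul_le_mul_left_of_nonneg (hD0 b hb) (h2.trans (le_add_of_nonneg_right one_nonneg'))
        refine h6.trans (le_trans (le_of_eq ?_) h7)
        ring
      have h8 := mul_le_mul_left_of_nonneg hm0 h5
      refine h8.trans (le_of_eq ?_)
      have h9 : algebraMap ℝ A m * (N * N + 1) = 1 := by
        rw [hN, ← map_mul, ← map_one (algebraMap ℝ A), ← map_add, ← map_mul, hm,
          inv_mul_cancel₀ hpos.ne']
      linear_combination b * h9
    have h10 : algebraMap ℝ A ((n : ℝ) * n + 1) * algebraMap ℝ A m = 1 := by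
      rw [← map_mul, hm, mul_inv_cancel₀ hpos.ne', map_one]
    linear_combination algebraMap ℝ A ((n : ℝ) * n + 1) * h4 - (c * x) * h10
  have h11 : c * (N - w) ≤ c * x := mul_le_mul_left_of_nonneg hc0 le_sup_left
  rw [h3, mul_sub, sub_nonpos] at h11
  rwa [nsmul_eq_mul, hNc, mul_comm]

theorem IsCountablePartition.mul_eq_zero {x : ℕ → A} {e : A} (hx : IsCountablePartition x e)
    {n m : ℕ} (hnm : n ≠ m) : x n * x m = 0 := by
  have := hx.disjoint n m hnm
  rw [abs_of_nonneg (idem_nonneg (hx.idem n)), abs_of_nonneg (idem_nonneg (hx.idem m))] at this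
  exact mul_eq_zero_of_inf_eq_zero this

/-- Elements that are comparable on each member of a countable partition of `1` are comparable. -/
theorem le_of_forall_partition_mul_le
    (hA : SigmaOrderContinuous (fun p : Ici (0 : A) × Ici (0 : A) => (p.1 : A) * (p.2 : A)))
    {x : ℕ → A} (hx : IsCountablePartition x 1) {a b : A} (h : ∀ n, x n * a ≤ x n * b) :
    a ≤ b := by
  have hx0 : ∀ n, 0 ≤ x n := fun n => idem_nonneg (hx.idem n)
  -- Order continuity concerns monotone sequences, so the pieces are replaced by their partial sums,
  -- which increase to `1` and annihilate `(a - b)⁺`.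
  set s : ℕ → A := fun n => ∑ k ∈ Finset.range n, x k with hs
  have hs0 : ∀ n, 0 ≤ s n := fun n => Finset.sum_nonneg fun k _ => hx0 k
  have hsx : ∀ n m, n ≤ m → s n * x m = 0 := fun n m hnm => by
    rw [hs, Finset.sum_mul]
    exact Finset.sum_eq_zero fun k hk => hx.mul_eq_zero (by have := Finset.mem_range.1 hk; omega)
  have hsi : ∀ n, IsIdempotentElem (s n) := fun n => by
    induction n with
    | zero => simp [hs, IsIdempotentElem]
    | succ n ih =>
      have e : s (n + 1) = s n + x n := Finset.sum_range_succ _ _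
      have h1 := hsx n n le_rfl
      have h2 := (hx.idem n).eq
      have h3 := ih.eq
      rw [IsIdempotentElem, e]
      linear_combination 2 * h1 + h2 + h3
  have hmono : Monotone s := monotone_nat_of_le_succ fun n => by
    rw [hs]; simp only [Finset.sum_range_succ]
    exact le_add_of_nonneg_right (hx0 n)
  have hlub : IsLUB (range s) 1 := by
    refine ⟨?_, fun c hc => hx.isLUB.2 ?_⟩
    · rintro _ ⟨n, rfl⟩; exact idem_le_one (hsi n)
    · rintro _ ⟨n, rfl⟩
      refine le_trans ?_ (hc ⟨n + 1, rfl⟩)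
      simp only [hs, Finset.sum_range_succ]
      exact le_add_of_nonneg_left (hs0 n)
  have hw0 : 0 ≤ (a - b)⁺ := posPart_nonneg _
  have hw : ∀ n, x n * (a - b)⁺ = 0 := fun n => by
    rw [← posPart_mul (hx0 n), posPart_eq_zero, mul_sub, sub_nonpos]
    exact h n
  have hsw : ∀ n, s n * (a - b)⁺ = 0 := fun n => by
    rw [hs, Finset.sum_mul]; exact Finset.sum_eq_zero fun k _ => hw k
  have key := hA.2.1 (fun n => (⟨s n, hs0 n⟩, ⟨(a - b)⁺, hw0⟩))
    (⟨1, one_nonneg'⟩, ⟨(a - b)⁺, hw0⟩) (fun n m hnm => ⟨hmono hnm, le_rfl⟩) (by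
      refine ⟨?_, fun c hc => ⟨hlub.2 ?_, (hc ⟨0, rfl⟩).2⟩⟩
      · rintro _ ⟨n, rfl⟩; exact ⟨hlub.1 ⟨n, rfl⟩, le_rfl⟩
      · rintro _ ⟨n, rfl⟩; exact (hc ⟨n, rfl⟩).1)
  have h1 : (1 : A) * (a - b)⁺ ≤ 0 := key.2 (by
    rintro _ ⟨n, rfl⟩; exact (hsw n).le)
  rw [one_mul] at h1
  exact sub_nonpos.1 (posPart_eq_zero.1 (le_antisymm h1 hw0))

/-- Both `y` and `1 - y` annihilate `x ⊓ y`: the first because `x ⊓ y ≤ x`, the second because `x ⊓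
y ≤ y`. -/
theorem idem_disjoint_of_mul_eq_zero {x y : A} (hx : IsIdempotentElem x) (hy : IsIdempotentElem y)
    (h : x * y = 0) : |x| ⊓ |y| = 0 := by
  have hx0 := idem_nonneg hx
  have hy0 := idem_nonneg hy
  rw [abs_of_nonneg hx0, abs_of_nonneg hy0]
  have h0 : 0 ≤ x ⊓ y := le_inf hx0 hy0
  have h1 : y * (x ⊓ y) ≤ 0 := by
    rw [← h, mul_comm x]; exact mul_le_mul_left_of_nonneg hy0 inf_le_left
  have h2 : (1 - y) * (x ⊓ y) ≤ 0 := by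
    have := mul_le_mul_left_of_nonneg (idem_nonneg hy.one_sub) (inf_le_right (a := x) (b := y))
    rwa [sub_mul 1 y y, hy.eq, one_mul, sub_self] at this
  refine le_antisymm ?_ h0
  have := add_nonpos h1 h2
  rwa [← add_mul, add_sub_cancel, one_mul] at this

end FAlg

/-! ### Metric Riesz spaces -/

section MetricRiesz

variable {E : Type*} [AddCommGroup E] [Module ℝ E] [Lattice E] [MetricSpace E] [MetricRieszSpace E]

theorem dist_eq_dist_sub_zero (x y : E) : dist x y = dist (x - y) 0 := by
  rw [MetricRieszSpace.dist_add_right_eq x y (-y), add_neg_cancel, sub_eq_add_neg]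

theorem dist_zero_le_of_abs_le {x y : E} (h : |x| ≤ y) : dist x 0 ≤ dist y 0 := by
  rw [MetricRieszSpace.dist_abs_zero x]
  exact MetricRieszSpace.dist_zero_mono _ _ (abs_nonneg x) h

theorem dist_add_zero_le (x y : E) : dist (x + y) 0 ≤ dist x 0 + dist y 0 := by
  have h := dist_triangle (x + y) y 0
  have := MetricRieszSpace.dist_add_right_eq x 0 y
  rw [zero_add] at this
  linarith

theorem dist_neg_zero (x : E) : dist (-x) 0 = dist x 0 := by
  rw [MetricRieszSpace.dist_abs_zero, abs_neg, ← MetricRieszSpace.dist_abs_zero]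

theorem dist_le_of_abs_sub_le {x y z : E} (h : |x - y| ≤ z) : dist x y ≤ dist z 0 := by
  rw [dist_eq_dist_sub_zero]; exact dist_zero_le_of_abs_le h

theorem isTopologicalAddGroup_of_metricRiesz : IsTopologicalAddGroup E := by
  refine { continuous_add := ?_, continuous_neg := ?_ }
  · refine Metric.continuous_iff.2 fun p ε hε => ⟨ε / 2, by positivity, fun q hq => ?_⟩
    have h : dist (q.1 + q.2) (p.1 + p.2) ≤ dist q.1 p.1 + dist q.2 p.2 := by
      rw [dist_eq_dist_sub_zero, dist_eq_dist_sub_zero q.1, dist_eq_dist_sub_zero q.2,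
        add_sub_add_comm]
      exact dist_add_zero_le _ _
    have h1 : dist q.1 p.1 ≤ dist q p := le_max_left _ _
    have h2 : dist q.2 p.2 ≤ dist q p := le_max_right _ _
    linarith
  · refine Metric.continuous_iff.2 fun p ε hε => ⟨ε, hε, fun q hq => ?_⟩
    rw [dist_eq_dist_sub_zero, neg_sub_neg, ← neg_sub, dist_neg_zero, ← dist_eq_dist_sub_zero]
    exact hq

theorem continuous_abs' : Continuous fun x : E => |x| :=
  Metric.continuous_iff.2 fun p ε hε => ⟨ε, hε, fun q hq => lt_of_le_of_lt (by
    rw [dist_eq_dist_sub_zero q p, MetricRieszSpace.dist_abs_zero (q - p)]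
    exact dist_le_of_abs_sub_le (abs_abs_sub_abs_le q p)) hq⟩

/-- The relation `a ≤ b` amounts to `|b - a| = b - a`, an equation between continuous functions. -/
theorem orderClosedTopology_of_metricRiesz : OrderClosedTopology E := by
  have := isTopologicalAddGroup_of_metricRiesz (E := E)
  refine ⟨?_⟩
  have : {p : E × E | p.1 ≤ p.2} = {p : E × E | |p.2 - p.1| = p.2 - p.1} := by
    ext p
    exact ⟨fun h => abs_of_nonneg (sub_nonneg.2 h),
      fun h => sub_nonneg.1 (le_of_le_of_eq (abs_nonneg _) h)⟩
  rw [this]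
  exact isClosed_eq (continuous_abs'.comp (continuous_snd.sub continuous_fst))
    (continuous_snd.sub continuous_fst)

end MetricRiesz

/-! ### Metric `f`-structures -/

section Str

variable {A : Type u} [CommRing A] [Algebra ℝ A] [Lattice A]

section Triple

variable {S : FTriple A}

instance : Module S.U S.V where
  one_smul v := Subtype.ext (one_mul (v : A))
  mul_smul x y v := Subtype.ext (mul_assoc (x : A) y v)
  smul_zero x := Subtype.ext (mul_zero (x : A))
  smul_add x v w := Subtype.ext (mul_add (x : A) v w)
  add_smul x y v := Subtype.ext (add_mul (x : A) y v)
  zero_smul v := Subtype.ext (zero_mul (v : A))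

theorem sub_smul_V (x y : S.U) (v : S.V) : (x - y) • v = x • v - y • v := sub_smul x y v

theorem algebraMap_smul_V (r : ℝ) (v : S.V) : algebraMap ℝ S.U r • v = r • v :=
  Subtype.ext (Algebra.smul_def r (v : A)).symm

end Triple

variable {S : MetricFStructure A}

instance : CompleteSpace S.U := S.isMetric.metricFAlgebra.complete
instance : CompleteSpace S.V := S.isMetric.metricRiesz.complete
instance : IsTopologicalAddGroup S.U := isTopologicalAddGroup_of_metricRiesz
instance : IsTopologicalAddGroup S.V := isTopologicalAddGroup_of_metricRiesz
instance : OrderClosedTopology S.V := orderClosedTopology_of_metricRiesz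
instance : ContinuousMul S.U := ⟨S.isMetric.metricFAlgebra.continuous_mul'⟩
instance : ContinuousSMul S.U S.V := ⟨S.isMetric.continuous_smul'⟩

theorem fAlgebra_ambient (S : MetricFStructure A) : FAlgebra A :=
  have := S.isMetric.localisable
  inferInstance

theorem smul_le_smul_V {x : S.U} {a b : S.V} (hx : 0 ≤ x) (h : a ≤ b) : x • a ≤ x • b :=
  haveI := fAlgebra_ambient S
  mul_le_mul_left_of_nonneg (A := A) (z := x) (x := a) (y := b) hx h

theorem smul_nonneg_V {x : S.U} {a : S.V} (hx : 0 ≤ x) (h : 0 ≤ a) : 0 ≤ x • a := by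
  have := smul_le_smul_V hx h
  rwa [smul_zero] at this

theorem smul_le_smul_right_V {x y : S.U} {a : S.V} (hxy : x ≤ y) (h : 0 ≤ a) : x • a ≤ y • a := by
  have := smul_nonneg_V (sub_nonneg.2 hxy) h
  rwa [sub_smul_V, sub_nonneg] at this

theorem smul_le_self_V {x : S.U} {a : S.V} (hx : IsIdempotentElem x) (h : 0 ≤ a) : x • a ≤ a := by
  have := smul_le_smul_right_V (idem_le_one hx) h
  rwa [one_smul] at this

/-- A countable partition of `1` in `U` is one in the ambient algebra. -/
theorem IsCountablePartition.coe {x : ℕ → S.U} (hx : IsCountablePartition x 1) :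
    IsCountablePartition (fun n => (x n : A)) 1 := by
  have := fAlgebra_ambient S
  refine ⟨fun n => congrArg Subtype.val (hx.idem n).eq,
    fun n m h => congrArg Subtype.val (hx.disjoint n m h), ?_, fun c hc => ?_⟩
  · rintro _ ⟨n, rfl⟩; exact hx.isLUB.1 ⟨n, rfl⟩
  · have hc0 : 0 ≤ c := le_trans (idem_nonneg (hx.idem 0) : (0 : S.U) ≤ x 0) (hc ⟨0, rfl⟩)
    -- An upper bound `c` in the ambient algebra need not lie in `U`, but `c ⊓ 1` does by solidity
    -- and is still an upper bound.
    have hd0 : 0 ≤ c ⊓ 1 := le_inf hc0 one_nonneg'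
    have hd : c ⊓ 1 ∈ S.U.toSubalgebra := S.isMetric.solidU _ 1 (one_mem _) (by
      rw [abs_of_nonneg hd0, abs_of_nonneg one_nonneg']; exact inf_le_right)
    have h : (1 : S.U) ≤ ⟨c ⊓ 1, hd⟩ := hx.isLUB.2 (by
      rintro _ ⟨n, rfl⟩
      exact (le_inf (hc ⟨n, rfl⟩) (idem_le_one (hx.idem n) : x n ≤ 1) : ((x n : S.U) : A) ≤ c ⊓ 1))
    exact le_trans (h : (1 : A) ≤ c ⊓ 1) inf_le_left

/-- The pieces lie in `U` and the vectors in `V`. The comparison takes place in the ambient algebra,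
which contains both and has an order-continuous product. -/
theorem IsCountablePartition.le_V {x : ℕ → S.U} (hx : IsCountablePartition x 1) {a b : S.V}
    (h : ∀ n, x n • a ≤ x n • b) : a ≤ b :=
  haveI := fAlgebra_ambient S
  le_of_forall_partition_mul_le (A := A) S.isMetric.localisable.mul_sigmaOrderContinuous hx.coe h

theorem IsCountablePartition.le_U {x : ℕ → S.U} (hx : IsCountablePartition x 1) {a b : S.U}
    (h : ∀ n, x n * a ≤ x n * b) : a ≤ b :=
  haveI := fAlgebra_ambient S
  le_of_forall_partition_mul_le (A := A) S.isMetric.localisable.mul_sigmaOrderContinuous hx.coe h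

theorem IsCountablePartition.eq_V {x : ℕ → S.U} (hx : IsCountablePartition x 1) {a b : S.V}
    (h : ∀ n, x n • a = x n • b) : a = b :=
  le_antisymm (hx.le_V fun n => (h n).le) (hx.le_V fun n => (h n).ge)

theorem IsCountablePartition.nonneg {x : ℕ → S.U} (hx : IsCountablePartition x 1) (n : ℕ) :
    0 ≤ x n := idem_nonneg (hx.idem n)

theorem IsCountablePartition.smul_self {x : ℕ → S.U} (hx : IsCountablePartition x 1) (n : ℕ)
    {X : Type*} [AddCommGroup X] [Module S.U X] (a : X) : x n • x n • a = x n • a := by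
  rw [← mul_smul, (hx.idem n).eq]

theorem IsCountablePartition.smul_self_V {x : ℕ → S.U} (hx : IsCountablePartition x 1) (n : ℕ)
    (a : S.V) : x n • x n • a = x n • a := hx.smul_self n a

/-- Refinement of a countable partition by a family of countable partitions. -/
theorem IsCountablePartition.refine {x : ℕ → S.U} {y : ℕ → ℕ → S.U}
    (hx : IsCountablePartition x 1) (hy : ∀ n, IsCountablePartition (y n) 1) :
    IsCountablePartition (fun k => x k.unpair.1 * y k.unpair.1 k.unpair.2) 1 := by
  have hi : ∀ k : ℕ, IsIdempotentElem (x k.unpair.1 * y k.unpair.1 k.unpair.2) := fun k =>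
    (hx.idem _).mul ((hy _).idem _)
  refine ⟨hi, fun k l hkl => idem_disjoint_of_mul_eq_zero (hi k) (hi l) ?_, ?_, fun c hc => ?_⟩
  · by_cases h : k.unpair.1 = l.unpair.1
    · have h2 : k.unpair.2 ≠ l.unpair.2 := fun h2 => hkl (by
        rw [← Nat.pair_unpair k, ← Nat.pair_unpair l, h, h2])
      have := (hy l.unpair.1).mul_eq_zero h2
      rw [h]
      linear_combination (x l.unpair.1 * x l.unpair.1) * this
    · linear_combination (y k.unpair.1 k.unpair.2 * y l.unpair.1 l.unpair.2) * hx.mul_eq_zero h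
  · rintro _ ⟨k, rfl⟩; exact idem_le_one (hi k)
  · have h : ∀ n m, x n * y n m ≤ c := fun n m => hc ⟨Nat.pair n m, by simp⟩
    refine hx.isLUB.2 ?_
    rintro _ ⟨n, rfl⟩
    -- The supremum is reached in two stages: `x n ≤ c` is tested along the partition `y n`, and
    -- then the supremum over `n` is taken.
    refine (hy n).le_U fun m => ?_
    have := mul_le_mul_left_of_nonneg ((hy n).nonneg m) (h n m)
    rwa [mul_left_comm, ((hy n).idem m).eq, mul_comm] at this

/-- The partition `1, 0, 0, …` makes any single element a glueing of a constant sequence. -/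
theorem isCountablePartition_single :
    IsCountablePartition (fun n : ℕ => if n = 0 then (1 : S.U) else 0) 1 := by
  refine ⟨fun n => ?_, fun n m h => ?_, ?_, fun c hc => hc ⟨0, by simp⟩⟩
  · by_cases h : n = 0 <;> simp [h, IsIdempotentElem]
  · refine idem_disjoint_of_mul_eq_zero ?_ ?_ ?_
    · by_cases h : n = 0 <;> simp [h, IsIdempotentElem]
    · by_cases h : m = 0 <;> simp [h, IsIdempotentElem]
    · by_cases h1 : n = 0
      · subst h1; simp [h.symm]
      · simp [h1]
  · rintro _ ⟨n, rfl⟩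
    by_cases h : n = 0
    · simp [h]
    · simpa [h] using one_nonneg'

/-- Bounded families of positive elements of `V` can be glued along a countable partition. -/
theorem IsCountablePartition.exists_glue {x : ℕ → S.U} (hx : IsCountablePartition x 1)
    {a : ℕ → S.V} {c : S.V} (ha : ∀ n, 0 ≤ a n) (hc : ∀ n, x n • a n ≤ c) :
    ∃ s : S.V, IsLUB (range fun n => x n • a n) s ∧ ∀ n, x n • s = x n • a n := by
  obtain ⟨s, hs⟩ := S.isMetric.metricRiesz.sigmaComplete'.1 (range fun n => x n • a n)
    (countable_range _) (range_nonempty _) ⟨c, by rintro _ ⟨n, rfl⟩; exact hc n⟩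
  refine ⟨s, hs, fun m => le_antisymm ?_ ?_⟩
  · have h : s ≤ x m • a m + (1 - x m) • s := hs.2 (by
      rintro _ ⟨n, rfl⟩
      have h0 : 0 ≤ 1 - x m := idem_nonneg (hx.idem m).one_sub
      have hsn : x n • a n ≤ s := hs.1 ⟨n, rfl⟩
      have hs0 : 0 ≤ s := (smul_nonneg_V (hx.nonneg n) (ha n)).trans hsn
      by_cases hnm : n = m
      · subst hnm
        exact le_add_of_nonneg_right (smul_nonneg_V h0 hs0)
      · refine le_trans ?_ (le_add_of_nonneg_left (smul_nonneg_V (hx.nonneg m) (ha m)))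
        refine le_trans (le_of_eq ?_) (smul_le_smul_V h0 hsn)
        rw [← mul_smul, sub_mul, one_mul, hx.mul_eq_zero (Ne.symm hnm), sub_zero])
    have := smul_le_smul_V (hx.nonneg m) h
    rwa [smul_add, hx.smul_self_V, ← mul_smul (x m) (1 - x m), mul_sub, mul_one, (hx.idem m).eq,
      sub_self, zero_smul, add_zero] at this
  · rw [← hx.smul_self_V m (a m)]
    exact smul_le_smul_V (hx.nonneg m) (hs.1 ⟨m, rfl⟩)

/-- A finite partition of `1`, extended by zero, is a countable partition. -/
theorem IsFinitePartition.toCountable {k : ℕ} {x : Fin k → S.U} (hx : IsFinitePartition x 1) :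
    IsCountablePartition (fun n : ℕ => if h : n < k then x ⟨n, h⟩ else 0) 1 := by
  have hi : ∀ n : ℕ, IsIdempotentElem (if h : n < k then x ⟨n, h⟩ else 0) := fun n => by
    by_cases h : n < k
    · simpa [h] using hx.idem _
    · simp [h, IsIdempotentElem]
  have hd : ∀ i j, i ≠ j → x i * x j = 0 := fun i j hij => by
    have := hx.disjoint i j hij
    rw [abs_of_nonneg (idem_nonneg (hx.idem i)), abs_of_nonneg (idem_nonneg (hx.idem j))] at this
    exact mul_eq_zero_of_inf_eq_zero this
  refine ⟨hi, fun n m h => idem_disjoint_of_mul_eq_zero (hi n) (hi m) ?_, ?_, fun c hc => ?_⟩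
  · by_cases h1 : n < k
    · by_cases h2 : m < k
      · simp only [h1, h2, dif_pos]
        exact hd _ _ fun h3 => h (by simpa using h3)
      · simp [h2]
    · simp [h1]
  · rintro _ ⟨n, rfl⟩; exact idem_le_one (hi n)
  · have h : ∀ i, x i ≤ c := fun i => hc ⟨i, by simp⟩
    have h1 : ∀ i, x i ≤ x i * c := fun i => by
      have := mul_le_mul_left_of_nonneg (idem_nonneg (hx.idem i)) (h i)
      rwa [(hx.idem i).eq] at this
    calc (1 : S.U) = ∑ i, x i := hx.sum_eq.symm
      _ ≤ ∑ i, x i * c := Finset.sum_le_sum fun i _ => h1 i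
      _ = c := by rw [← Finset.sum_mul, hx.sum_eq, one_mul]

theorem IsFinitePartition.mul_sum_smul {k : ℕ} {x : Fin k → S.U} (hx : IsFinitePartition x 1)
    (r : Fin k → ℝ) (j : Fin k) : x j * ∑ i, r i • x i = r j • x j := by
  have hd : ∀ i, i ≠ j → x j * x i = 0 := fun i hij => by
    have := hx.disjoint j i hij.symm
    rw [abs_of_nonneg (idem_nonneg (hx.idem i)), abs_of_nonneg (idem_nonneg (hx.idem j))] at this
    exact mul_eq_zero_of_inf_eq_zero this
  rw [Finset.mul_sum, Finset.sum_eq_single j]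
  · rw [mul_smul_comm, (hx.idem j).eq]
  · intro i _ hij
    rw [mul_smul_comm, hd i hij, smul_zero]
  · simp

end Str

/-! ### Normed modules -/

section NM

variable {A : Type u} [CommRing A] [Algebra ℝ A] [Lattice A] {S : MetricFStructure A}

namespace NormMod

variable {M : NormMod.{u, w} S} {N : NormMod.{u, w'} S}

theorem dist_def (v v' : M) : dist v v' = dist (M.pnorm (v - v')) 0 := rfl

theorem real_smul_def (r : ℝ) (v : M) : r • v = algebraMap ℝ S.U r • v := rfl

theorem pnorm_zero (M : NormMod.{u, w} S) : M.pnorm 0 = 0 := (M.pnorm_eq_zero 0).2 rfl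

theorem pnorm_real_smul (r : ℝ) (v : M) : M.pnorm (r • v) = |r| • M.pnorm v := by
  rw [real_smul_def, M.pnorm_smul, abs_algebraMap, algebraMap_smul_V]

theorem pnorm_smul_of_nonneg {x : S.U} (hx : 0 ≤ x) (v : M) : M.pnorm (x • v) = x • M.pnorm v := by
  rw [M.pnorm_smul, abs_of_nonneg hx]

theorem abs_pnorm_sub_le (v v' : M) : |M.pnorm v - M.pnorm v'| ≤ M.pnorm (v - v') := by
  have h : ∀ a b : M, M.pnorm a - M.pnorm b ≤ M.pnorm (a - b) := fun a b => by
    have := M.pnorm_add_le (a - b) b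
    rwa [sub_add_cancel, ← sub_le_iff_le_add] at this
  refine abs_le'.2 ⟨h v v', ?_⟩
  rw [neg_sub, ← M.pnorm_neg (v - v'), neg_sub]
  exact h v' v

theorem continuous_pnorm : Continuous M.pnorm :=
  Metric.continuous_iff.2 fun p ε hε => ⟨ε, hε, fun q hq =>
    lt_of_le_of_lt (dist_le_of_abs_sub_le (abs_pnorm_sub_le q p)) hq⟩

theorem tendsto_iff_pnorm {ι : Type*} {l : Filter ι} {f : ι → M} {v : M} :
    Tendsto f l (𝓝 v) ↔ Tendsto (fun i => M.pnorm (f i - v)) l (𝓝 0) := by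
  rw [tendsto_iff_dist_tendsto_zero,
    tendsto_iff_dist_tendsto_zero (f := fun i => M.pnorm (f i - v))]
  rfl

theorem tendsto_of_pnorm_le {ι : Type*} {l : Filter ι} {f : ι → M} {v : M} {g : ι → S.V}
    (h : ∀ i, M.pnorm (f i - v) ≤ g i) (hg : Tendsto g l (𝓝 0)) : Tendsto f l (𝓝 v) := by
  rw [tendsto_iff_dist_tendsto_zero] at hg ⊢
  exact squeeze_zero (fun _ => dist_nonneg)
    (fun i => MetricRieszSpace.dist_zero_mono _ _ (M.pnorm_nonneg _) (h i)) hg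

instance (M : NormMod.{u, w} S) : IsTopologicalAddGroup M where
  continuous_add := continuous_iff_continuousAt.2 fun p => by
    refine tendsto_of_pnorm_le (g := fun q : M × M => M.pnorm (q.1 - p.1) + M.pnorm (q.2 - p.2))
      (fun q => ?_) ?_
    · rw [add_sub_add_comm]; exact M.pnorm_add_le _ _
    · have h1 := tendsto_iff_pnorm.1 (continuous_fst.tendsto p)
      have h2 := tendsto_iff_pnorm.1 (continuous_snd.tendsto p)
      simpa using h1.add h2
  continuous_neg := continuous_iff_continuousAt.2 fun p => by
    refine tendsto_of_pnorm_le (g := fun q : M => M.pnorm (q - p)) (fun q => ?_)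
      (tendsto_iff_pnorm.1 tendsto_id)
    rw [neg_sub_neg, ← M.pnorm_neg, neg_sub]

instance (M : NormMod.{u, w} S) : ContinuousSMul S.U M where
  continuous_smul := continuous_iff_continuousAt.2 fun p => by
    refine tendsto_of_pnorm_le (g := fun q : S.U × M =>
      |q.1| • M.pnorm (q.2 - p.2) + |q.1 - p.1| • M.pnorm p.2) (fun q => ?_) ?_
    · rw [← M.pnorm_smul, ← M.pnorm_smul, smul_sub, sub_smul]
      refine le_trans (le_of_eq ?_) (M.pnorm_add_le _ _)
      congr 1; abel
    · have h1 : Tendsto (fun q : S.U × M => |q.1|) (𝓝 p) (𝓝 |p.1|) :=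
        (continuous_abs'.comp continuous_fst).tendsto p
      have h2 := tendsto_iff_pnorm.1 (continuous_snd.tendsto p)
      have h3 : Tendsto (fun q : S.U × M => |q.1 - p.1|) (𝓝 p) (𝓝 |p.1 - p.1|) :=
        (continuous_abs'.comp (continuous_fst.sub continuous_const)).tendsto p
      have h4 := (h1.smul h2).add (h3.smul (tendsto_const_nhds (x := M.pnorm p.2)))
      rwa [smul_zero, sub_self, abs_zero, zero_smul, add_zero] at h4

theorem _root_.FMod.IsCountablePartition.ext {x : ℕ → S.U} (hx : IsCountablePartition x 1)
    {v v' : M} (h : ∀ n, x n • v = x n • v') : v = v' := by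
  refine sub_eq_zero.1 ((M.pnorm_eq_zero _).1 (hx.eq_V fun n => ?_))
  rw [← pnorm_smul_of_nonneg (hx.nonneg n), smul_sub, h n, sub_self, pnorm_zero, smul_zero]

theorem orderBounded_of_le {f : ℕ → M} {c : S.V} (h : ∀ n, M.pnorm (f n) ≤ c) :
    OrderBounded (range fun n => M.pnorm (f n)) :=
  ⟨⟨c, by rintro _ ⟨n, rfl⟩; exact h n⟩, ⟨0, by rintro _ ⟨n, rfl⟩; exact M.pnorm_nonneg _⟩⟩

theorem continuous_of_pnorm_le (T : M →ₗ[S.U] N) {b : S.U}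
    (hb : ∀ v, N.pnorm (T v) ≤ b • M.pnorm v) : Continuous T :=
  continuous_iff_continuousAt.2 fun p => by
    refine tendsto_of_pnorm_le (g := fun q : M => b • M.pnorm (q - p)) (fun q => ?_) ?_
    · rw [← map_sub]; exact hb _
    · have h := (tendsto_const_nhds (x := b)).smul (tendsto_iff_pnorm.1 (tendsto_id (x := 𝓝 p)))
      rwa [smul_zero] at h

/-- Bounded homomorphisms that agree on a set with dense glueings are equal. -/
theorem eq_of_eqOn {T T' : M →ₗ[S.U] N} (hT : T ∈ homs M N) (hT' : T' ∈ homs M N) {s : Set M}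
    (hs : Dense (M.glue s)) (h : ∀ v ∈ s, T v = T' v) : T = T' := by
  obtain ⟨b, -, hb⟩ := hT
  obtain ⟨b', -, hb'⟩ := hT'
  refine LinearMap.ext fun z => congrFun ((continuous_of_pnorm_le T hb).ext_on hs
    (continuous_of_pnorm_le T' hb') ?_) z
  rintro z ⟨x, v, hx, hv, -, hz⟩
  refine hx.ext fun n => ?_
  rw [← map_smul, ← map_smul, hz, map_smul, map_smul, h _ (hv n)]

end NormMod

/-! ### Step elements -/

/-- Elements that are a real multiple of each member of a countable partition of `1`. -/
def IsStep (u : S.U) : Prop :=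
  ∃ (x : ℕ → S.U) (r : ℕ → ℝ), IsCountablePartition x 1 ∧
    ∀ n, x n * u = algebraMap ℝ S.U (r n) * x n

theorem isStep_of_mem_simpleElements {u : S.U} (hu : u ∈ simpleElements S.U) : IsStep u := by
  obtain ⟨k, r, x, hx, rfl⟩ := hu
  refine ⟨_, fun n => if h : n < k then r ⟨n, h⟩ else 0, hx.toCountable, fun n => ?_⟩
  by_cases h : n < k
  · simp only [h, dif_pos]
    rw [hx.mul_sum_smul, Algebra.smul_def]
  · simp [h]

/-- By density, compatibility with scalars of `U` has to be checked only for scalars that are real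
on each piece, where real linearity suffices. -/
theorem dense_isStep : Dense {u : S.U | IsStep u} :=
  S.isMetric.metricFAlgebra.dense_simple.mono fun _ => isStep_of_mem_simpleElements

/-! ### Extension of maps from generators -/

namespace NormMod

variable {X : Type w''} [AddCommGroup X] [Module ℝ X] {P : NormMod.{u, w} S}
  {Q : NormMod.{u, w'} S}

/-- Pairs obtained by glueing the pairs `(p v, t v)` along a common partition. -/
def glueRel (p : X →ₗ[ℝ] P) (t : X →ₗ[ℝ] Q) : Set (P × Q) :=
  {q | ∃ (x : ℕ → S.U) (v : ℕ → X), IsCountablePartition x 1 ∧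
    ∀ n, x n • q.1 = x n • p (v n) ∧ x n • q.2 = x n • t (v n)}

variable {p : X →ₗ[ℝ] P} {t : X →ₗ[ℝ] Q}

theorem mk_mem_glueRel (v : X) : (p v, t v) ∈ glueRel p t :=
  ⟨_, fun _ => v, isCountablePartition_single, fun _ => ⟨rfl, rfl⟩⟩

theorem add_mem_glueRel {q q' : P × Q} (h : q ∈ glueRel p t) (h' : q' ∈ glueRel p t) :
    q + q' ∈ glueRel p t := by
  obtain ⟨x, v, hx, hv⟩ := h
  obtain ⟨y, v', hy, hv'⟩ := h'
  refine ⟨_, fun k => v k.unpair.1 + v' k.unpair.2, hx.refine fun _ => hy, fun k => ?_⟩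
  have h1 := hv k.unpair.1
  have h2 := hv' k.unpair.2
  constructor
  · rw [Prod.fst_add, map_add, smul_add, smul_add]
    congr 1
    · rw [mul_smul, smul_comm, h1.1, smul_comm, ← mul_smul]
    · rw [mul_smul, h2.1, ← mul_smul]
  · rw [Prod.snd_add, map_add, smul_add, smul_add]
    congr 1
    · rw [mul_smul, smul_comm, h1.2, smul_comm, ← mul_smul]
    · rw [mul_smul, h2.2, ← mul_smul]

/-- On each piece of the refined partition `u` acts as a real number, which passes through the
real-linear maps `p` and `t`. -/
theorem smul_mem_glueRel {u : S.U} (hu : IsStep u) {q : P × Q} (h : q ∈ glueRel p t) :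
    u • q ∈ glueRel p t := by
  obtain ⟨x, v, hx, hv⟩ := h
  obtain ⟨y, r, hy, hr⟩ := hu
  refine ⟨_, fun k => r k.unpair.2 • v k.unpair.1, hx.refine fun _ => hy, fun k => ?_⟩
  have h1 := hv k.unpair.1
  have h2 := hr k.unpair.2
  have h3 : x k.unpair.1 * y k.unpair.2 * u =
      (algebraMap ℝ S.U (r k.unpair.2) * y k.unpair.2) * x k.unpair.1 := by
    rw [← h2]; ring
  constructor
  · rw [Prod.smul_fst, map_smul, real_smul_def, ← mul_smul, ← mul_smul, h3, mul_smul, h1.1,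
      ← mul_smul]
    congr 1; ring
  · rw [Prod.smul_snd, map_smul, real_smul_def, ← mul_smul, ← mul_smul, h3, mul_smul, h1.2,
      ← mul_smul]
    congr 1; ring

theorem pnorm_le_of_mem_glueRel {c : S.U} (hc : ∀ v, Q.pnorm (t v) ≤ c • P.pnorm (p v))
    {q : P × Q} (h : q ∈ glueRel p t) : Q.pnorm q.2 ≤ c • P.pnorm q.1 := by
  obtain ⟨x, v, hx, hv⟩ := h
  refine hx.le_V fun n => ?_
  rw [smul_comm, ← pnorm_smul_of_nonneg (hx.nonneg n), ← pnorm_smul_of_nonneg (hx.nonneg n),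
    (hv n).1, (hv n).2, pnorm_smul_of_nonneg (hx.nonneg n), pnorm_smul_of_nonneg (hx.nonneg n),
    smul_comm]
  exact smul_le_smul_V (hx.nonneg n) (hc _)

/-- The bound `c` transfers order-boundedness from the pieces in `P` to their images in `Q`, so the
images can be glued as well. -/
theorem exists_mem_glueRel {c : S.U} (hc0 : 0 ≤ c)
    (hc : ∀ v, Q.pnorm (t v) ≤ c • P.pnorm (p v)) {z : P} (hz : z ∈ P.glue (range p)) :
    ∃ y, (z, y) ∈ glueRel p t := by
  obtain ⟨x, v, hx, hv, ⟨⟨b, hb⟩, -⟩, hz⟩ := hz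
  choose v' hv' using hv
  obtain ⟨y, hy⟩ := Q.glueing x hx (fun n => t (v' n)) (orderBounded_of_le (c := c • b) fun n => by
    have h1 : P.pnorm (x n • v n) ≤ b := hb ⟨n, rfl⟩
    refine le_trans ?_ (smul_le_smul_V hc0 h1)
    rw [pnorm_smul_of_nonneg (hx.nonneg n), pnorm_smul_of_nonneg (hx.nonneg n), ← hv', smul_comm c]
    exact smul_le_smul_V (hx.nonneg n) (hc _))
  exact ⟨y, x, v', hx, fun n => ⟨by rw [hv', hz], hy n⟩⟩

theorem add_mem_closure_glueRel {q q' : P × Q} (h : q ∈ closure (glueRel p t))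
    (h' : q' ∈ closure (glueRel p t)) : q + q' ∈ closure (glueRel p t) :=
  map_mem_closure₂ continuous_add h h' fun _ ha _ hb => add_mem_glueRel ha hb

theorem smul_mem_closure_glueRel (u : S.U) {q : P × Q} (h : q ∈ closure (glueRel p t)) :
    u • q ∈ closure (glueRel p t) :=
  map_mem_closure₂ (f := fun (a : S.U) (b : P × Q) => a • b) continuous_smul (dense_isStep u) h
    fun _ ha _ hb => smul_mem_glueRel ha hb

theorem pnorm_le_of_mem_closure_glueRel {c : S.U} (hc : ∀ v, Q.pnorm (t v) ≤ c • P.pnorm (p v))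
    {q : P × Q} (h : q ∈ closure (glueRel p t)) : Q.pnorm q.2 ≤ c • P.pnorm q.1 :=
  closure_minimal (t := {q : P × Q | Q.pnorm q.2 ≤ c • P.pnorm q.1})
    (fun _ => pnorm_le_of_mem_glueRel hc)
    (isClosed_le (continuous_pnorm.comp continuous_snd)
      (Continuous.smul (f := fun _ => c) (g := fun q : P × Q => P.pnorm q.1) continuous_const
        (continuous_pnorm.comp continuous_fst))) h

theorem sub_mem_closure_glueRel {q q' : P × Q} (h : q ∈ closure (glueRel p t))
    (h' : q' ∈ closure (glueRel p t)) : q - q' ∈ closure (glueRel p t) := by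
  have := add_mem_closure_glueRel h (smul_mem_closure_glueRel (-1) h')
  rwa [neg_one_smul, ← sub_eq_add_neg] at this

theorem eq_of_mem_closure_glueRel {c : S.U} (hc : ∀ v, Q.pnorm (t v) ≤ c • P.pnorm (p v))
    {z : P} {y y' : Q} (h : (z, y) ∈ closure (glueRel p t)) (h' : (z, y') ∈ closure (glueRel p t)) :
    y = y' := by
  have h1 := pnorm_le_of_mem_closure_glueRel hc (sub_mem_closure_glueRel h h')
  simp only [Prod.mk_sub_mk, sub_self, pnorm_zero, smul_zero] at h1
  exact sub_eq_zero.1 ((Q.pnorm_eq_zero _).1 (le_antisymm h1 (Q.pnorm_nonneg _)))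

/-- Approximate `z` by glueings. The norm inequality applied to differences makes their partners in
`Q` a Cauchy sequence. -/
theorem exists_mem_closure_glueRel [CompleteSpace Q] {c : S.U} (hc0 : 0 ≤ c)
    (hc : ∀ v, Q.pnorm (t v) ≤ c • P.pnorm (p v)) (hp : Dense (P.glue (range p))) (z : P) :
    ∃ y, (z, y) ∈ closure (glueRel p t) := by
  obtain ⟨a, ha, haz⟩ := mem_closure_iff_seq_limit.1 (hp z)
  choose y hy using fun n => exists_mem_glueRel hc0 hc (ha n)
  have hcau : CauchySeq y := by
    rw [cauchySeq_iff_tendsto_dist_atTop_0]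
    have h1 : Tendsto (fun n : ℕ × ℕ => a n.1 - a n.2) atTop (𝓝 (z - z)) := by
      rw [← prod_atTop_atTop_eq]
      exact (haz.comp tendsto_fst).sub (haz.comp tendsto_snd)
    have h2 : Tendsto (fun n : ℕ × ℕ => c • P.pnorm (a n.1 - a n.2)) atTop (𝓝 0) := by
      have := (tendsto_const_nhds (x := c)).smul ((continuous_pnorm.tendsto _).comp h1)
      rwa [sub_self, pnorm_zero, smul_zero] at this
    refine squeeze_zero (fun _ => dist_nonneg) (fun n => ?_) (tendsto_iff_dist_tendsto_zero.1 h2)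
    refine MetricRieszSpace.dist_zero_mono _ _ (Q.pnorm_nonneg _) ?_
    exact pnorm_le_of_mem_closure_glueRel hc
      (sub_mem_closure_glueRel (subset_closure (hy n.1)) (subset_closure (hy n.2)))
  obtain ⟨l, hl⟩ := cauchySeq_tendsto_of_complete hcau
  exact ⟨l, mem_closure_of_tendsto (haz.prodMk_nhds hl) (Eventually.of_forall hy)⟩

/-- A map on generators that is bounded by a multiple of the pointwise norm extends. -/
theorem exists_extension [CompleteSpace Q] {c : S.U} (hc0 : 0 ≤ c)
    (hc : ∀ v, Q.pnorm (t v) ≤ c • P.pnorm (p v)) (hp : Dense (P.glue (range p))) :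
    ∃ T : P →ₗ[S.U] Q, (∀ v, T (p v) = t v) ∧ ∀ z, Q.pnorm (T z) ≤ c • P.pnorm z := by
  -- The closed relation is total by this line and single-valued by `eq_of_mem_closure_glueRel`;
  -- linearity of `T` is its stability under the module operations.
  choose T hT using exists_mem_closure_glueRel hc0 hc hp
  refine ⟨{ toFun := T, map_add' := fun z z' => ?_, map_smul' := fun u z => ?_ }, fun v => ?_,
    fun z => pnorm_le_of_mem_closure_glueRel hc (hT z)⟩
  · exact eq_of_mem_closure_glueRel hc (hT _) (add_mem_closure_glueRel (hT z) (hT z'))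
  · exact eq_of_mem_closure_glueRel hc (hT _) (smul_mem_closure_glueRel u (hT z))
  · exact eq_of_mem_closure_glueRel hc (hT _) (subset_closure (mk_mem_glueRel v))

end NormMod

end NM

/-! ### The glued completion of a seminormed vector space -/

section Completion

variable {A : Type u} [CommRing A] [Algebra ℝ A] [Lattice A]

/-- A `V`-valued seminorm on a real vector space. -/
structure VSeminorm (S : MetricFStructure A) (X : Type w) [AddCommGroup X] [Module ℝ X] where
  toFun : X → S.V
  nonneg : ∀ v, 0 ≤ toFun v
  zero : toFun 0 = 0
  add_le : ∀ v v', toFun (v + v') ≤ toFun v + toFun v'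
  smul_eq : ∀ (r : ℝ) v, toFun (r • v) = |r| • toFun v

variable {S : MetricFStructure A}

/-! ### Locally constant functions on a countable partition -/

section LocConst

variable {Y : Type*} {Z : Type*}

/-- `f` takes the value `v n` at all non-zero elements below `x n`. -/
def LocConst (x : ℕ → S.U) (v : ℕ → Y) (f : S.U → Y) : Prop :=
  ∀ n b, b ≠ 0 → b * x n = b → f b = v n

theorem LocConst.refine_left {x : ℕ → S.U} {v : ℕ → Y} {f : S.U → Y} (h : LocConst x v f)
    (hx : IsCountablePartition x 1) (y : ℕ → ℕ → S.U) :
    LocConst (fun k => x k.unpair.1 * y k.unpair.1 k.unpair.2) (fun k => v k.unpair.1) f :=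
  fun k b hb hbk => h _ b hb (by
    have h1 := (hx.idem k.unpair.1).eq
    linear_combination (x k.unpair.1 - 1) * (-hbk) + b * y k.unpair.1 k.unpair.2 * h1)

theorem LocConst.refine_right {x : ℕ → S.U} {y : ℕ → ℕ → S.U} {v : ℕ → ℕ → Y} {f : ℕ → S.U → Y}
    {g : S.U → Y} (h : ∀ n, LocConst (y n) (v n) (f n)) (hx : IsCountablePartition x 1)
    (hy : ∀ n, IsCountablePartition (y n) 1)
    (hg : ∀ n b, b ≠ 0 → b * x n = b → g b = f n b) :
    LocConst (fun k => x k.unpair.1 * y k.unpair.1 k.unpair.2)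
      (fun k => v k.unpair.1 k.unpair.2) g := fun k b hb hbk => by
  have h1 := (hx.idem k.unpair.1).eq
  have h2 := ((hy k.unpair.1).idem k.unpair.2).eq
  rw [hg k.unpair.1 b hb (by
    linear_combination (x k.unpair.1 - 1) * (-hbk) + b * y k.unpair.1 k.unpair.2 * h1)]
  exact h _ _ b hb (by
    linear_combination (y k.unpair.1 k.unpair.2 - 1) * (-hbk) + b * x k.unpair.1 * h2)

theorem LocConst.exists_common {x y : ℕ → S.U} {v : ℕ → Y} {v' : ℕ → Z} {f : S.U → Y}
    {g : S.U → Z} (hx : IsCountablePartition x 1) (hy : IsCountablePartition y 1)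
    (hf : LocConst x v f) (hg : LocConst y v' g) :
    ∃ (z : ℕ → S.U) (i j : ℕ → ℕ), IsCountablePartition z 1 ∧ (∀ k, z k = x (i k) * y (j k)) ∧
      LocConst z (fun k => v (i k)) f ∧ LocConst z (fun k => v' (j k)) g :=
  ⟨_, _, _, hx.refine fun _ => hy, fun _ => rfl, hf.refine_left hx fun _ => y,
    LocConst.refine_right (fun _ => hg) hx (fun _ => hy) fun _ _ _ _ => rfl⟩

/-- The function that agrees with `f n` below `x n`. -/
noncomputable def glueFun (x : ℕ → S.U) (f : ℕ → S.U → Y) (b : S.U) : Y :=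
  f (Classical.epsilon fun n => b * x n = b) b

/-- Distinct pieces are orthogonal, so a non-zero `b` lies below at most one of them and the chosen
index has to be `n`. -/
theorem glueFun_eq {x : ℕ → S.U} (hx : IsCountablePartition x 1) (f : ℕ → S.U → Y) (n : ℕ)
    (b : S.U) (hb : b ≠ 0) (hbn : b * x n = b) : glueFun x f b = f n b := by
  have h : b * x (Classical.epsilon fun n => b * x n = b) = b :=
    Classical.epsilon_spec (p := fun n => b * x n = b) ⟨n, hbn⟩
  by_cases hn : (Classical.epsilon fun n => b * x n = b) = n
  · rw [glueFun, hn]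
  · refine absurd ?_ hb
    have h1 := hx.mul_eq_zero hn
    rw [← hbn, ← h, mul_assoc, h1, mul_zero]

theorem LocConst.add {x : ℕ → S.U} [Add Y] {v v' : ℕ → Y} {f g : S.U → Y} (hf : LocConst x v f)
    (hg : LocConst x v' g) : LocConst x (fun n => v n + v' n) (f + g) :=
  fun n b hb hbn => by rw [Pi.add_apply, hf n b hb hbn, hg n b hb hbn]

end LocConst

/-! ### Pointwise norm and glueing of bounded locally constant functions -/

namespace VSeminorm

variable {X : Type w} [AddCommGroup X] [Module ℝ X] (N : VSeminorm S X)

/-- Locally constant functions that are bounded with respect to the seminorm. -/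
def IsPre (f : S.U → X) : Prop :=
  ∃ (x : ℕ → S.U) (v : ℕ → X) (c : S.V), IsCountablePartition x 1 ∧ LocConst x v f ∧
    ∀ n, x n • N.toFun (v n) ≤ c

variable {N}

/-- The norm is glued from one representation of `f`. Any other representation gives the same
result, because on a non-zero overlap `z n * x m` both local values equal `f (z n * x m)`. -/
theorem IsPre.exists_pnorm {f : S.U → X} (hf : N.IsPre f) :
    ∃ a : S.V, ∀ (z : ℕ → S.U) (v : ℕ → X), IsCountablePartition z 1 → LocConst z v f →
      ∀ n, z n • a = z n • N.toFun (v n) := by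
  obtain ⟨x, v, c, hx, hv, hc⟩ := hf
  obtain ⟨a, -, ha⟩ := hx.exists_glue (fun n => N.nonneg (v n)) hc
  refine ⟨a, fun z v' hz hv' n => hx.eq_V fun m => ?_⟩
  rw [smul_comm, ha, smul_comm]
  by_cases h : z n * x m = 0
  · rw [← mul_smul, ← mul_smul, mul_comm, h, zero_smul, zero_smul]
  · rw [← hv m (z n * x m) h (by rw [mul_assoc, (hx.idem m).eq]),
      ← hv' n (z n * x m) h (by rw [mul_right_comm, (hz.idem n).eq])]

variable (N) in
/-- The pointwise norm of a locally constant function. -/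
noncomputable def pn (f : S.U → X) : S.V :=
  open scoped Classical in if h : N.IsPre f then h.exists_pnorm.choose else 0

theorem IsPre.smul_pn {f : S.U → X} (hf : N.IsPre f) {z : ℕ → S.U} {v : ℕ → X}
    (hz : IsCountablePartition z 1) (hv : LocConst z v f) (n : ℕ) :
    z n • N.pn f = z n • N.toFun (v n) := by
  rw [pn, dif_pos hf]
  exact hf.exists_pnorm.choose_spec z v hz hv n

theorem IsPre.exists_rep {f : S.U → X} (hf : N.IsPre f) : ∃ (x : ℕ → S.U) (v : ℕ → X),
    IsCountablePartition x 1 ∧ LocConst x v f := by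
  obtain ⟨x, v, c, hx, hv, hc⟩ := hf
  exact ⟨x, v, hx, hv⟩

theorem IsPre.exists_rep₂ {f g : S.U → X} (hf : N.IsPre f) (hg : N.IsPre g) :
    ∃ (x : ℕ → S.U) (v v' : ℕ → X),
    IsCountablePartition x 1 ∧ LocConst x v f ∧ LocConst x v' g := by
  obtain ⟨x, v, hx, hv⟩ := hf.exists_rep
  obtain ⟨y, v', hy, hv'⟩ := hg.exists_rep
  obtain ⟨z, i, j, hz, -, h1, h2⟩ := LocConst.exists_common hx hy hv hv'
  exact ⟨z, _, _, hz, h1, h2⟩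

theorem IsPre.pn_nonneg {f : S.U → X} (hf : N.IsPre f) : 0 ≤ N.pn f := by
  obtain ⟨x, v, hx, hv⟩ := hf.exists_rep
  refine hx.le_V fun n => ?_
  rw [hf.smul_pn hx hv, smul_zero]
  exact smul_nonneg_V (hx.nonneg n) (N.nonneg _)

theorem isPre_const (v : X) : N.IsPre fun _ => v :=
  ⟨_, fun _ => v, N.toFun v, isCountablePartition_single, fun _ _ _ _ => rfl, fun n =>
    smul_le_self_V (isCountablePartition_single.idem n) (N.nonneg v)⟩

theorem pn_const (v : X) : N.pn (fun _ => v) = N.toFun v :=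
  isCountablePartition_single.eq_V fun n =>
    (isPre_const v).smul_pn (v := fun _ => v) isCountablePartition_single (fun _ _ _ _ => rfl) n

theorem IsPre.add {f g : S.U → X} (hf : N.IsPre f) (hg : N.IsPre g) : N.IsPre (f + g) := by
  obtain ⟨x, v, v', hx, hv, hv'⟩ := hf.exists_rep₂ hg
  refine ⟨x, _, N.pn f + N.pn g, hx, hv.add hv', fun n => ?_⟩
  refine (smul_le_smul_V (hx.nonneg n) (N.add_le _ _)).trans ?_
  rw [smul_add, ← hf.smul_pn hx hv, ← hg.smul_pn hx hv', ← smul_add]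
  exact smul_le_self_V (hx.idem n) (add_nonneg hf.pn_nonneg hg.pn_nonneg)

theorem IsPre.pn_add_le {f g : S.U → X} (hf : N.IsPre f) (hg : N.IsPre g) :
    N.pn (f + g) ≤ N.pn f + N.pn g := by
  obtain ⟨x, v, v', hx, hv, hv'⟩ := hf.exists_rep₂ hg
  refine hx.le_V fun n => ?_
  rw [(hf.add hg).smul_pn hx (hv.add hv'), smul_add, hf.smul_pn hx hv,
    hg.smul_pn hx hv', ← smul_add]
  exact smul_le_smul_V (hx.nonneg n) (N.add_le _ _)

/-- Locally constant functions that agree below `e` have the same norm there. -/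
theorem IsPre.smul_pn_congr {f g : S.U → X} (hf : N.IsPre f) (hg : N.IsPre g) {e : S.U}
    (he : IsIdempotentElem e) (h : ∀ b, b ≠ 0 → b * e = b → f b = g b) :
    e • N.pn f = e • N.pn g := by
  obtain ⟨x, v, v', hx, hv, hv'⟩ := hf.exists_rep₂ hg
  refine hx.eq_V fun n => ?_
  rw [smul_comm, hf.smul_pn hx hv, smul_comm (x n), hg.smul_pn hx hv']
  by_cases h0 : e * x n = 0
  · rw [← mul_smul, ← mul_smul, h0, zero_smul, zero_smul]
  · have h1 : e * x n * x n = e * x n := by rw [mul_assoc, (hx.idem n).eq]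
    rw [← hv n (e * x n) h0 h1, ← hv' n (e * x n) h0 h1,
      h (e * x n) h0 (by rw [mul_right_comm, he.eq])]

/-- Locally constant functions can be glued. -/
theorem exists_glue_isPre {x : ℕ → S.U} (hx : IsCountablePartition x 1) {f : ℕ → S.U → X}
    (hf : ∀ n, N.IsPre (f n)) {c : S.V} (hc : ∀ n, x n • N.pn (f n) ≤ c) :
    ∃ g, N.IsPre g ∧ ∀ n b, b ≠ 0 → b * x n = b → g b = f n b := by
  choose y v hy hv using fun n => (hf n).exists_rep
  refine ⟨glueFun x f, ⟨_, _, c, hx.refine hy, LocConst.refine_right hv hx hy (glueFun_eq hx f),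
    fun k => ?_⟩, glueFun_eq hx f⟩
  have h0 : 0 ≤ c := (smul_nonneg_V (hx.nonneg 0) (hf 0).pn_nonneg).trans (hc 0)
  rw [mul_smul, ← (hf _).smul_pn (hy _) (hv _), smul_comm]
  exact (smul_le_smul_V ((hy _).nonneg _) (hc _)).trans (smul_le_self_V ((hy _).idem _) h0)

end VSeminorm

/-! ### Step functions -/

variable (S) in
/-- Step elements of `U` together with a function giving their local values. -/
def IsStepPair (q : S.U × (S.U → ℝ)) : Prop :=
  ∃ (x : ℕ → S.U) (r : ℕ → ℝ), IsCountablePartition x 1 ∧ LocConst x r q.2 ∧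
    ∀ n, x n * q.1 = algebraMap ℝ S.U (r n) * x n

theorem IsStepPair.exists_common {Y : Type*} {q : S.U × (S.U → ℝ)} (hq : IsStepPair S q)
    {y : ℕ → S.U} (hy : IsCountablePartition y 1) {v : ℕ → Y} {f : S.U → Y}
    (hf : LocConst y v f) :
    ∃ (z : ℕ → S.U) (r : ℕ → ℝ) (j : ℕ → ℕ), IsCountablePartition z 1 ∧
      LocConst z r q.2 ∧ LocConst z (fun k => v (j k)) f ∧
      (∀ n, z n * q.1 = algebraMap ℝ S.U (r n) * z n) ∧ ∀ n, z n * y (j n) = z n := by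
  obtain ⟨x, r, hx, hr, hq⟩ := hq
  obtain ⟨z, i, j, hz, hij, h1, h2⟩ := LocConst.exists_common hx hy hr hf
  refine ⟨z, _, j, hz, h1, h2, fun n => ?_, fun n => ?_⟩
  · rw [hij]
    linear_combination y (j n) * hq (i n)
  · rw [hij, mul_assoc, (hy.idem _).eq]

theorem IsStepPair.exists_common₂ {q q' : S.U × (S.U → ℝ)} (hq : IsStepPair S q)
    (hq' : IsStepPair S q') :
    ∃ (z : ℕ → S.U) (r r' : ℕ → ℝ), IsCountablePartition z 1 ∧
      LocConst z r q.2 ∧ LocConst z r' q'.2 ∧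
      (∀ n, z n * q.1 = algebraMap ℝ S.U (r n) * z n) ∧
      (∀ n, z n * q'.1 = algebraMap ℝ S.U (r' n) * z n) := by
  obtain ⟨y, r', hy, hr', hq'⟩ := hq'
  obtain ⟨z, r, j, hz, h1, h2, h3, h4⟩ := hq.exists_common hy hr'
  refine ⟨z, r, _, hz, h1, h2, h3, fun n => ?_⟩
  rw [← h4 n]
  linear_combination z n * hq' (j n)

theorem IsStepPair.mul {q q' : S.U × (S.U → ℝ)} (hq : IsStepPair S q)
    (hq' : IsStepPair S q') : IsStepPair S (q * q') := by
  obtain ⟨z, r, r', hz, h1, h2, h3, h4⟩ := hq.exists_common₂ hq'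
  refine ⟨z, fun n => r n * r' n, hz, fun n b hb hbn => ?_, fun n => ?_⟩
  · rw [Prod.snd_mul, Pi.mul_apply, h1 n b hb hbn, h2 n b hb hbn]
  · rw [Prod.fst_mul, map_mul]
    linear_combination q'.1 * h3 n + algebraMap ℝ S.U (r n) * h4 n

theorem IsStepPair.const (r : ℝ) : IsStepPair S (algebraMap ℝ S.U r, fun _ => r) :=
  ⟨_, fun _ => r, isCountablePartition_single, fun _ _ _ _ => rfl, fun _ => mul_comm _ _⟩

variable (S) in
/-- The group of step pairs. -/
def stepGroup : AddSubgroup (S.U × (S.U → ℝ)) where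
  carrier := {q | IsStepPair S q}
  zero_mem' := by
    have := IsStepPair.const (S := S) 0
    rwa [map_zero] at this
  add_mem' {q q'} hq hq' := by
    obtain ⟨z, r, r', hz, h1, h2, h3, h4⟩ := IsStepPair.exists_common₂ hq hq'
    refine ⟨z, fun n => r n + r' n, hz, fun n b hb hbn => ?_, fun n => ?_⟩
    · rw [Prod.snd_add, Pi.add_apply, h1 n b hb hbn, h2 n b hb hbn]
    · rw [Prod.fst_add, map_add]
      linear_combination h3 n + h4 n
  neg_mem' {q} hq := by
    obtain ⟨z, r, hz, h1, h2⟩ := hq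
    refine ⟨z, fun n => - r n, hz, fun n b hb hbn => ?_, fun n => ?_⟩
    · rw [Prod.snd_neg, Pi.neg_apply, h1 n b hb hbn]
    · rw [Prod.fst_neg, map_neg]
      linear_combination - h2 n

variable (S) in
/-- The type of step pairs, with the topology induced from `U`. -/
def Step : Type u := stepGroup S

instance : AddCommGroup (Step S) := inferInstanceAs (AddCommGroup (stepGroup S))

variable (S) in
/-- The underlying element of a step pair. -/
def Step.val : Step S →+ S.U := (AddMonoidHom.fst _ _).comp (stepGroup S).subtype

instance : TopologicalSpace (Step S) := TopologicalSpace.induced (Step.val S) inferInstance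

instance : IsTopologicalAddGroup (Step S) := topologicalAddGroup_induced (Step.val S)

theorem Step.exists_val_eq {u : S.U} (hu : IsStep u) : ∃ q : Step S, Step.val S q = u := by
  obtain ⟨x, r, hx, hr⟩ := hu
  exact ⟨⟨(u, glueFun x fun n _ => r n), x, r, hx,
    fun n b hb hbn => glueFun_eq hx (fun n _ => r n) n b hb hbn, hr⟩, rfl⟩

/-- Together with the dense inclusion of `Pre N` in its completion, this allows a biadditive map on
`Step S × Pre N` to be extended by continuity to an action of `U`. -/
theorem Step.isDenseInducing_val : IsDenseInducing (Step.val S) where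
  eq_induced := rfl
  dense := dense_isStep.mono fun _ hu => Step.exists_val_eq hu

end Completion

section Completion

variable {A : Type u} [CommRing A] [Algebra ℝ A] [Lattice A] {S : MetricFStructure A}

/-! ### The seminormed group of locally constant functions -/

namespace VSeminorm

variable {X : Type w} [AddCommGroup X] [Module ℝ X] {N : VSeminorm S X}

/-- A step pair acts on locally constant functions. -/
theorem IsPre.exists_rep_smul {f : S.U → X} (hf : N.IsPre f) {q : S.U × (S.U → ℝ)}
    (hq : IsStepPair S q) : ∃ (z : ℕ → S.U) (v : ℕ → X), IsCountablePartition z 1 ∧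
      LocConst z v (q.2 • f) ∧ ∀ n, z n • N.toFun (v n) = z n • |q.1| • N.pn f := by
  obtain ⟨x, v, hx, hv⟩ := hf.exists_rep
  obtain ⟨z, r, j, hz, h1, h2, h3, -⟩ := hq.exists_common hx hv
  refine ⟨z, fun k => r k • v (j k), hz, fun n b hb hbn => ?_, fun n => ?_⟩
  · rw [Pi.smul_apply', h1 n b hb hbn, h2 n b hb hbn]
  · have h4 : z n * |q.1| = algebraMap ℝ S.U |r n| * z n := by
      rw [← abs_mul_of_nonneg (hz.nonneg n), h3, mul_comm, abs_mul_of_nonneg (hz.nonneg n),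
        abs_algebraMap, mul_comm]
    rw [N.smul_eq, ← mul_smul, h4, mul_smul, hf.smul_pn hz h2, ← algebraMap_smul_V, smul_comm]

theorem IsPre.smul {f : S.U → X} (hf : N.IsPre f) {q : S.U × (S.U → ℝ)}
    (hq : IsStepPair S q) : N.IsPre (q.2 • f) := by
  obtain ⟨z, v, hz, hv, h⟩ := hf.exists_rep_smul hq
  refine ⟨z, v, |q.1| • N.pn f, hz, hv, fun n => ?_⟩
  rw [h]
  exact smul_le_self_V (hz.idem n) (smul_nonneg_V (abs_nonneg _) hf.pn_nonneg)

theorem IsPre.pn_smul {f : S.U → X} (hf : N.IsPre f) {q : S.U × (S.U → ℝ)}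
    (hq : IsStepPair S q) : N.pn (q.2 • f) = |q.1| • N.pn f := by
  obtain ⟨z, v, hz, hv, h⟩ := hf.exists_rep_smul hq
  exact hz.eq_V fun n => by rw [(hf.smul hq).smul_pn hz hv, h]

theorem IsPre.neg {f : S.U → X} (hf : N.IsPre f) : N.IsPre (-f) := by
  have h := hf.smul (IsStepPair.const (-1))
  have e : ((fun _ => -1 : S.U → ℝ) • f) = -f := by
    funext b; simp
  rwa [e] at h

theorem IsPre.pn_neg {f : S.U → X} (hf : N.IsPre f) : N.pn (-f) = N.pn f := by
  have h := hf.pn_smul (IsStepPair.const (-1))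
  have e : ((fun _ => -1 : S.U → ℝ) • f) = -f := by
    funext b; simp
  simp only [e, map_neg, map_one, abs_neg] at h
  rw [h, abs_of_nonneg one_nonneg', one_smul]

theorem isPre_zero : N.IsPre 0 := isPre_const 0

theorem pn_zero : N.pn 0 = 0 := (pn_const 0).trans N.zero

variable (N) in
/-- The group of locally constant functions. -/
def preGroup : AddSubgroup (S.U → X) where
  carrier := {f | N.IsPre f}
  zero_mem' := isPre_zero
  add_mem' := IsPre.add
  neg_mem' := IsPre.neg

variable (N) in
/-- The type of locally constant functions. -/
def Pre : Type (max u w) := preGroup N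

instance : AddCommGroup (Pre N) := inferInstanceAs (AddCommGroup (preGroup N))

/-- The pointwise norm of an element of `Pre N`. -/
noncomputable def Pre.pnorm (f : Pre N) : S.V := N.pn f.1

theorem Pre.pnorm_nonneg (f : Pre N) : 0 ≤ f.pnorm := IsPre.pn_nonneg f.2

theorem Pre.pnorm_add_le (f g : Pre N) : (f + g).pnorm ≤ f.pnorm + g.pnorm :=
  IsPre.pn_add_le f.2 g.2

/-- Only a group seminorm is available: the distance of `V` need not be homogeneous under real
scalars. The completion is therefore that of an abelian group, and scalars are put back afterwards.
-/
noncomputable instance : SeminormedAddCommGroup (Pre N) :=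
  AddGroupSeminorm.toSeminormedAddCommGroup
    { toFun := fun f => dist f.pnorm 0
      map_zero' := by
        have : (0 : Pre N).pnorm = 0 := pn_zero
        rw [this, dist_self]
      add_le' := fun f g => (MetricRieszSpace.dist_zero_mono _ _ (f + g).pnorm_nonneg
        (f.pnorm_add_le g)).trans (dist_add_zero_le _ _)
      neg' := fun f => by
        have : (-f).pnorm = f.pnorm := IsPre.pn_neg f.2
        rw [this] }

theorem Pre.norm_def (f : Pre N) : ‖f‖ = dist f.pnorm 0 := rfl

theorem Pre.abs_pnorm_sub_le (f g : Pre N) : |f.pnorm - g.pnorm| ≤ (f - g).pnorm := by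
  have h : ∀ a b : Pre N, a.pnorm - b.pnorm ≤ (a - b).pnorm := fun a b => by
    have := (a - b).pnorm_add_le b
    rwa [sub_add_cancel, ← sub_le_iff_le_add] at this
  refine abs_le'.2 ⟨h f g, ?_⟩
  have h1 : (-(f - g)).pnorm = (f - g).pnorm := IsPre.pn_neg (f - g).2
  rw [neg_sub, ← h1, neg_sub]
  exact h g f

theorem Pre.uniformContinuous_pnorm : UniformContinuous (Pre.pnorm : Pre N → S.V) :=
  LipschitzWith.uniformContinuous (K := 1) (LipschitzWith.of_dist_le_mul fun f g => by
    rw [NNReal.coe_one, one_mul, dist_eq_norm f g]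
    exact dist_le_of_abs_sub_le (abs_pnorm_sub_le f g))

/-- The action of step pairs on locally constant functions. -/
noncomputable def Pre.act : Step S →+ Pre N →+ Pre N :=
  AddMonoidHom.mk' (fun q => AddMonoidHom.mk' (fun f => ⟨q.1.2 • f.1, IsPre.smul f.2 q.2⟩)
    fun f g => Subtype.ext (smul_add q.1.2 f.1 g.1))
    fun q q' => AddMonoidHom.ext fun f => Subtype.ext (add_smul q.1.2 q'.1.2 f.1)

theorem Pre.pnorm_act (q : Step S) (f : Pre N) : (act q f).pnorm = |Step.val S q| • f.pnorm :=
  IsPre.pn_smul f.2 q.2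

theorem Pre.tendsto_of_pnorm_le {ι : Type*} {l : Filter ι} {f : ι → Pre N} {g : Pre N}
    {a : ι → S.V} (h : ∀ i, (f i - g).pnorm ≤ a i) (ha : Tendsto a l (𝓝 0)) :
    Tendsto f l (𝓝 g) := by
  rw [tendsto_iff_dist_tendsto_zero] at ha ⊢
  refine squeeze_zero (fun _ => dist_nonneg) (fun i => ?_) ha
  rw [dist_eq_norm (f i) g]
  exact MetricRieszSpace.dist_zero_mono _ _ (pnorm_nonneg _) (h i)

/-- This is the splitting of `q f - q₀ f₀` into `q (f - f₀) + (q - q₀) f₀`, measured by pointwise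
norms. -/
theorem Pre.continuous_act : Continuous fun p : Step S × Pre N => act p.1 p.2 :=
  continuous_iff_continuousAt.2 fun p => by
    have hv : Continuous (Step.val S) := Step.isDenseInducing_val.continuous
    refine tendsto_of_pnorm_le (a := fun q : Step S × Pre N =>
      |Step.val S q.1| • (q.2 - p.2).pnorm +
      |Step.val S (q.1 - p.1)| • p.2.pnorm) (fun q => ?_) ?_
    · rw [← pnorm_act, ← pnorm_act, map_sub, map_sub act q.1, AddMonoidHom.sub_apply]
      refine le_trans (le_of_eq ?_) (pnorm_add_le _ _)
      congr 1; abel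
    · have h1 : Tendsto (fun q : Step S × Pre N => |Step.val S q.1|) (𝓝 p) (𝓝 |Step.val S p.1|) :=
        (continuous_abs'.comp (hv.comp continuous_fst)).tendsto p
      have h2 : Tendsto (fun q : Step S × Pre N => (q.2 - p.2).pnorm) (𝓝 p)
          (𝓝 (p.2 - p.2).pnorm) :=
        (uniformContinuous_pnorm.continuous.comp (continuous_snd.sub continuous_const)).tendsto p
      have h3 : Tendsto (fun q : Step S × Pre N => |Step.val S (q.1 - p.1)|) (𝓝 p)
          (𝓝 |Step.val S (p.1 - p.1)|) :=
        (continuous_abs'.comp (hv.comp (continuous_fst.sub continuous_const))).tendsto p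
      have h4 := (h1.smul h2).add (h3.smul (tendsto_const_nhds (x := p.2.pnorm)))
      have h0 : (0 : Pre N).pnorm = 0 := pn_zero
      rwa [sub_self, sub_self, h0, smul_zero, map_zero, abs_zero, zero_smul, add_zero] at h4

/-! ### The completion -/

open UniformSpace (Completion)

variable (N) in
/-- The completion of the group of locally constant functions. -/
abbrev Compl : Type (max u w) := Completion (Pre N)

/-- The pointwise norm on the completion. -/
noncomputable def Compl.pnorm : Compl N → S.V := Completion.extension Pre.pnorm

theorem Compl.continuous_pnorm : Continuous (pnorm : Compl N → S.V) :=
  Completion.continuous_extension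

theorem Compl.pnorm_coe (f : Pre N) : pnorm (f : Compl N) = f.pnorm :=
  Completion.extension_coe Pre.uniformContinuous_pnorm f

theorem Compl.pnorm_nonneg (z : Compl N) : 0 ≤ pnorm z :=
  Completion.induction_on z (isClosed_le continuous_const continuous_pnorm) fun f => by
    rw [pnorm_coe]; exact f.pnorm_nonneg

theorem Compl.pnorm_add_le (z z' : Compl N) : pnorm (z + z') ≤ pnorm z + pnorm z' :=
  Completion.induction_on₂ z z' (isClosed_le (continuous_pnorm.comp continuous_add)
    ((continuous_pnorm.comp continuous_fst).add (continuous_pnorm.comp continuous_snd)))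
    fun f g => by
      rw [← Completion.coe_add, pnorm_coe, pnorm_coe, pnorm_coe]; exact f.pnorm_add_le g

theorem Compl.norm_eq (z : Compl N) : ‖z‖ = dist (pnorm z) 0 :=
  Completion.induction_on z (isClosed_eq continuous_norm
    (continuous_pnorm.dist continuous_const)) fun f => by
      rw [pnorm_coe, Completion.norm_coe, Pre.norm_def]

/-- The map `Step S × Pre N → Compl N` that is extended to the action of `U`. -/
noncomputable def Compl.preAct : Step S →+ Pre N →+ Compl N :=
  AddMonoidHom.mk' (fun q => Completion.toCompl.comp (Pre.act q)) fun q q' => by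
    rw [map_add, AddMonoidHom.comp_add]

theorem Compl.continuous_preAct :
    Continuous fun p : Step S × Pre N => (preAct p.1 p.2 : Compl N) :=
  (Completion.continuous_coe _).comp Pre.continuous_act

noncomputable instance : SMul S.U (Compl N) where
  smul x z := (Step.isDenseInducing_val.prodMap
    (Completion.isDenseInducing_toCompl (Pre N))).extend
    (fun p : Step S × Pre N => Compl.preAct p.1 p.2) (x, z)

/-- Joint continuity comes from the extension theorem for continuous biadditive maps with values in
a complete group. -/
theorem Compl.continuous_smul' : Continuous fun p : S.U × Compl N => p.1 • p.2 :=
  IsDenseInducing.extend_Z_bilin Step.isDenseInducing_val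
    (Completion.isDenseInducing_toCompl (Pre N)) continuous_preAct

theorem Compl.val_smul_coe (q : Step S) (f : Pre N) :
    Step.val S q • (f : Compl N) = (Pre.act q f : Compl N) :=
  (Step.isDenseInducing_val.prodMap
    (Completion.isDenseInducing_toCompl (Pre N))).extend_eq_at
      (a := (q, f)) continuous_preAct.continuousAt

theorem Compl.continuous_const_smul' (x : S.U) : Continuous fun z : Compl N => x • z :=
  continuous_smul'.comp (Continuous.prodMk continuous_const continuous_id)

theorem Compl.continuous_smul_const (z : Compl N) : Continuous fun x : S.U => x • z :=
  continuous_smul'.comp (Continuous.prodMk continuous_id continuous_const)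

/-- The module axioms are closed conditions. With this and induction on the completion they reduce
to pointwise identities between step pairs and locally constant functions. -/
theorem step_induction {p : S.U → Prop} (x : S.U) (hp : IsClosed {x | p x})
    (h : ∀ q : Step S, p (Step.val S q)) : p x :=
  Step.isDenseInducing_val.dense.induction_on (p := p) x hp h

theorem algebraMap_smul_coe (r : ℝ) (f : Pre N) :
    algebraMap ℝ S.U r • (f : Compl N) =
      ((Pre.act (⟨_, IsStepPair.const r⟩ : Step S) f : Pre N) : Compl N) :=
  Compl.val_smul_coe (⟨_, IsStepPair.const r⟩ : Step S) f

theorem compl_smul_add (x : S.U) (z z' : Compl N) : x • (z + z') = x • z + x • z' := by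
  refine step_induction x (isClosed_eq (Compl.continuous_smul_const _)
    ((Compl.continuous_smul_const z).add (Compl.continuous_smul_const z'))) fun q => ?_
  refine Completion.induction_on₂ z z'
    (isClosed_eq ((Compl.continuous_const_smul' _).comp continuous_add)
    (((Compl.continuous_const_smul' _).comp continuous_fst).add
      ((Compl.continuous_const_smul' _).comp continuous_snd))) fun f g => ?_
  change Step.val S q • ((f : Compl N) + (g : Compl N)) =
    Step.val S q • (f : Compl N) + Step.val S q • (g : Compl N)
  rw [← Completion.coe_add, Compl.val_smul_coe, Compl.val_smul_coe, Compl.val_smul_coe,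
    ← Completion.coe_add, map_add]

theorem compl_add_smul (x y : S.U) (z : Compl N) : (x + y) • z = x • z + y • z := by
  refine Completion.induction_on z (isClosed_eq (Compl.continuous_const_smul' _)
    ((Compl.continuous_const_smul' x).add (Compl.continuous_const_smul' y))) fun f => ?_
  refine step_induction x (isClosed_eq
    ((Compl.continuous_smul_const _).comp (continuous_id.add continuous_const))
    ((Compl.continuous_smul_const _).add continuous_const)) fun q => ?_
  refine step_induction y (isClosed_eq
    ((Compl.continuous_smul_const _).comp (continuous_const.add continuous_id))
    (continuous_const.add (Compl.continuous_smul_const _))) fun q' => ?_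
  change (Step.val S q + Step.val S q') • (f : Compl N) =
    Step.val S q • (f : Compl N) + Step.val S q' • (f : Compl N)
  rw [← map_add, Compl.val_smul_coe, Compl.val_smul_coe, Compl.val_smul_coe, ← Completion.coe_add,
    map_add, AddMonoidHom.add_apply]

theorem compl_mul_smul (x y : S.U) (z : Compl N) : (x * y) • z = x • y • z := by
  refine Completion.induction_on z (isClosed_eq (Compl.continuous_const_smul' _)
    ((Compl.continuous_const_smul' x).comp (Compl.continuous_const_smul' y))) fun f => ?_
  refine step_induction y (isClosed_eq
    ((Compl.continuous_smul_const _).comp (continuous_const.mul continuous_id))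
    ((Compl.continuous_const_smul' x).comp (Compl.continuous_smul_const _))) fun q' => ?_
  refine step_induction x (isClosed_eq
    ((Compl.continuous_smul_const _).comp (continuous_id.mul continuous_const))
    (Compl.continuous_smul_const _)) fun q => ?_
  change (Step.val S q * Step.val S q') • (f : Compl N) =
    Step.val S q • Step.val S q' • (f : Compl N)
  rw [Compl.val_smul_coe q', Compl.val_smul_coe q]
  refine (Compl.val_smul_coe (⟨_, q.2.mul q'.2⟩ : Step S) f).trans ?_
  exact congrArg _ (Subtype.ext (mul_smul q.1.2 q'.1.2 f.1))

theorem compl_one_smul (z : Compl N) : (1 : S.U) • z = z := by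
  refine Completion.induction_on z (isClosed_eq (Compl.continuous_const_smul' _)
    continuous_id) fun f => ?_
  rw [← map_one (algebraMap ℝ S.U), algebraMap_smul_coe]
  exact congrArg _ (Subtype.ext (one_smul (S.U → ℝ) f.1))

noncomputable instance : Module S.U (Compl N) where
  one_smul := compl_one_smul
  mul_smul := compl_mul_smul
  smul_add := compl_smul_add
  add_smul := compl_add_smul
  smul_zero x := by
    have := compl_smul_add x (0 : Compl N) 0
    rwa [add_zero, left_eq_add] at this
  zero_smul z := by
    have := compl_add_smul 0 0 z
    rwa [add_zero, left_eq_add] at this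

theorem Compl.pnorm_smul (x : S.U) (z : Compl N) : pnorm (x • z) = |x| • pnorm z := by
  refine Completion.induction_on z (isClosed_eq (continuous_pnorm.comp (continuous_const_smul' x))
    (Continuous.smul (f := fun _ => |x|) continuous_const continuous_pnorm)) fun f => ?_
  refine step_induction x (isClosed_eq (continuous_pnorm.comp (continuous_smul_const _))
    (Continuous.smul continuous_abs' continuous_const)) fun q => ?_
  change pnorm (Step.val S q • (f : Compl N)) = |Step.val S q| • pnorm (f : Compl N)
  rw [val_smul_coe, pnorm_coe, pnorm_coe, Pre.pnorm_act]

end VSeminorm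

end Completion

/-! ### Glueing in the completion, and density of the glued constants -/

section Completion

variable {A : Type u} [CommRing A] [Algebra ℝ A] [Lattice A] {S : MetricFStructure A}

namespace VSeminorm

open UniformSpace (Completion)

variable {X : Type w} [AddCommGroup X] [Module ℝ X] {N : VSeminorm S X}

theorem Compl.pnorm_smul_of_nonneg {x : S.U} (hx : 0 ≤ x) (z : Compl N) :
    pnorm (x • z) = x • pnorm z := by
  rw [pnorm_smul, abs_of_nonneg hx]

theorem Compl.pnorm_zero : pnorm (0 : Compl N) = 0 := by
  rw [← Completion.coe_zero, pnorm_coe]; exact pn_zero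

theorem Compl.pnorm_eq_zero (z : Compl N) : pnorm z = 0 ↔ z = 0 := by
  refine ⟨fun h => ?_, fun h => h ▸ pnorm_zero⟩
  rw [← norm_eq_zero, norm_eq, h, dist_self]

theorem Compl.pnorm_neg (z : Compl N) : pnorm (-z) = pnorm z := by
  have h := pnorm_smul (-1) z
  rw [neg_one_smul, abs_neg, abs_of_nonneg one_nonneg', one_smul] at h
  exact h

/-- An element of `Pre N` from a function. -/
def Pre.mk (f : S.U → X) (hf : N.IsPre f) : Pre N := ⟨f, hf⟩

/-- Approximate glueing in the completion. -/
theorem Compl.exists_approx_glue {x : ℕ → S.U} (hx : IsCountablePartition x 1) {z : ℕ → Compl N}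
    {c : S.V} (hc : ∀ n, pnorm (x n • z n) ≤ c) {ε : ℝ} (hε : 0 < ε) :
    ∃ (y : Compl N) (b : S.V), dist b 0 ≤ ε ∧ ∀ n, x n • pnorm (z n - y) ≤ b := by
  obtain ⟨δ, hδ, hglue⟩ := S.isMetric.glue_bound x hx ε hε
  -- The tolerances `δ / 2 / 2 ^ n` sum to `δ`, as the partition axiom demands.
  have hdense : ∀ n, ∃ f : Pre N, dist (z n) (f : Compl N) < δ / 2 / 2 ^ n := fun n =>
    (Completion.denseRange_coe).exists_dist_lt (z n) (by positivity)
  choose f hf using hdense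
  have hle : ∀ n, dist (x n • pnorm (z n - (f n : Compl N))) 0 ≤ δ / 2 / 2 ^ n := fun n => by
    refine (MetricRieszSpace.dist_zero_mono _ _ (smul_nonneg_V (hx.nonneg n) (pnorm_nonneg _))
      (smul_le_self_V (hx.idem n) (pnorm_nonneg _))).trans ?_
    rw [← norm_eq, ← dist_eq_norm]
    exact (hf n).le
  have hsum : Summable fun n => dist (x n • pnorm (z n - (f n : Compl N))) 0 :=
    Summable.of_nonneg_of_le (fun _ => dist_nonneg) hle (summable_geometric_two' δ)
  obtain ⟨⟨⟨c', hc'⟩, -⟩, hlub⟩ := hglue (fun n => pnorm (z n - (f n : Compl N)))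
    (fun n => pnorm_nonneg _) hsum ((hsum.tsum_le_tsum hle (summable_geometric_two' δ)).trans (tsum_geometric_two' δ).le)
  obtain ⟨b, hb, -⟩ := hx.exists_glue (fun n => pnorm_nonneg (z n - (f n : Compl N)))
    (fun n => hc' ⟨n, rfl⟩)
  have hbn : ∀ n, x n • pnorm (z n - (f n : Compl N)) ≤ b := fun n => hb.1 ⟨n, rfl⟩
  obtain ⟨g, hg, hgf⟩ := exists_glue_isPre hx (fun n => (f n).2) (c := c + b) fun n => by
    have h1 : pnorm (f n : Compl N) ≤ pnorm (z n) + pnorm (z n - (f n : Compl N)) := by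
      have := pnorm_add_le (z n) (-(z n - (f n : Compl N)))
      rwa [pnorm_neg, ← sub_eq_add_neg, sub_sub_cancel] at this
    have h2 := smul_le_smul_V (hx.nonneg n) h1
    rw [smul_add, ← pnorm_smul_of_nonneg (hx.nonneg n) (z n), pnorm_coe] at h2
    exact h2.trans (add_le_add (hc n) (hbn n))
  refine ⟨(Pre.mk g hg : Compl N), b, hlub b hb, fun n => ?_⟩
  have h1 : pnorm (z n - (Pre.mk g hg : Compl N)) ≤
      pnorm (z n - (f n : Compl N)) + (f n - Pre.mk g hg).pnorm := by
    rw [← pnorm_coe, Completion.coe_sub]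
    refine le_trans (le_of_eq ?_) (pnorm_add_le _ _)
    congr 1; abel
  -- Below `x n` the glued function `g` agrees with `f n`, so on that piece the error is only that
  -- of approximating `z n` by `f n`.
  have h2 : x n • (f n - Pre.mk g hg).pnorm = x n • N.pn 0 :=
    IsPre.smul_pn_congr (f n - Pre.mk g hg).2 isPre_zero (hx.idem n) fun b hb hbn => by
      change (f n).1 b - g b = 0
      rw [hgf n b hb hbn, sub_self]
  refine (smul_le_smul_V (hx.nonneg n) h1).trans ?_
  rw [smul_add, h2, pn_zero, smul_zero, add_zero]
  exact hbn n

/-- Approximate glueings with errors `1 / (k + 1)` form a Cauchy sequence: on every piece `y k` and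
`y l` are both near `z n`, with bounds `b k` and `b l` that do not depend on `n`. The limit is an
exact glueing. -/
theorem Compl.glueing {x : ℕ → S.U} (hx : IsCountablePartition x 1) {z : ℕ → Compl N}
    {c : S.V} (hc : ∀ n, pnorm (x n • z n) ≤ c) : ∃ y : Compl N, ∀ n, x n • y = x n • z n := by
  choose y b hb hy using fun k : ℕ => exists_approx_glue hx hc (ε := 1 / ((k : ℝ) + 1))
    (by positivity)
  have hdist : ∀ k l, dist (y k) (y l) ≤ 1 / ((k : ℝ) + 1) + 1 / ((l : ℝ) + 1) := fun k l => by
    have h1 : pnorm (y k - y l) ≤ b k + b l := hx.le_V fun n => by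
      have h2 : pnorm (y k - y l) ≤ pnorm (z n - y k) + pnorm (z n - y l) := by
        have := pnorm_add_le (-(z n - y k)) (z n - y l)
        rw [pnorm_neg] at this
        refine le_trans (le_of_eq ?_) this
        congr 1; abel
      have h3 := smul_le_smul_V (hx.nonneg n) h2
      rw [smul_add] at h3
      have h4 := smul_le_smul_V (hx.nonneg n) (h3.trans (add_le_add (hy k n) (hy l n)))
      rwa [hx.smul_self_V] at h4
    rw [dist_eq_norm, norm_eq]
    exact (MetricRieszSpace.dist_zero_mono _ _ (pnorm_nonneg _) h1).trans
      ((dist_add_zero_le _ _).trans (add_le_add (hb k) (hb l)))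
  have hcau : CauchySeq y := by
    refine cauchySeq_of_le_tendsto_0 (fun k : ℕ => 1 / ((k : ℝ) + 1) + 1 / ((k : ℝ) + 1))
      (fun n m k hn hm => (hdist n m).trans ?_) ?_
    · exact add_le_add (Nat.one_div_le_one_div hn) (Nat.one_div_le_one_div hm)
    · simpa using (tendsto_one_div_add_atTop_nhds_zero_nat (𝕜 := ℝ)).add
        (tendsto_one_div_add_atTop_nhds_zero_nat (𝕜 := ℝ))
  obtain ⟨l, hl⟩ := cauchySeq_tendsto_of_complete hcau
  refine ⟨l, fun n => ?_⟩
  have h1 : Tendsto (fun k => ‖x n • z n - x n • y k‖) atTop (𝓝 ‖x n • z n - x n • l‖) :=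
    (tendsto_const_nhds.sub (((continuous_const_smul' (x n)).tendsto l).comp hl)).norm
  have h2 : Tendsto (fun k => ‖x n • z n - x n • y k‖) atTop (𝓝 0) := by
    refine squeeze_zero (fun _ => norm_nonneg _) (fun k => ?_)
      (tendsto_one_div_add_atTop_nhds_zero_nat (𝕜 := ℝ))
    rw [← smul_sub, norm_eq, pnorm_smul_of_nonneg (hx.nonneg n)]
    exact (MetricRieszSpace.dist_zero_mono _ _ (smul_nonneg_V (hx.nonneg n) (pnorm_nonneg _))
      (hy k n)).trans (hb k)
  exact (sub_eq_zero.1 (norm_eq_zero.1 (tendsto_nhds_unique h1 h2))).symm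

variable (N) in
/-- The completion as a normed module. -/
noncomputable def complMod : NormMod.{u, max u w} S where
  carrier := Compl N
  pnorm := Compl.pnorm
  pnorm_nonneg := Compl.pnorm_nonneg
  pnorm_eq_zero := Compl.pnorm_eq_zero
  pnorm_add_le := Compl.pnorm_add_le
  pnorm_smul := Compl.pnorm_smul
  glueing _ hx _ hz := by
    obtain ⟨⟨c, hc⟩, -⟩ := hz
    exact Compl.glueing hx fun n => hc ⟨n, rfl⟩

variable (N) in
/-- The identification of the completion with the carrier of the normed module. -/
def complMod.of : Compl N → complMod N := id

theorem complMod.pnorm_of (z : Compl N) : (complMod N).pnorm (of N z) = Compl.pnorm z := rfl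

theorem complMod.of_sub (z z' : Compl N) : of N (z - z') = of N z - of N z' := rfl

theorem complMod.surjective_of : Function.Surjective (of N) := Function.surjective_id

/-- The same set carries the metric of a completion and the metric of a normed module; their
agreement transfers completeness and density. -/
theorem complMod.isometry_of : Isometry (of N) :=
  Isometry.of_dist_eq fun z z' => by
    rw [NormMod.dist_def, ← of_sub, pnorm_of, dist_eq_norm z z', Compl.norm_eq]

theorem isBanach_complMod : isBanach S (complMod N) :=
  (complMod.isometry_of.isUniformInducing.completeSpace_congr complMod.surjective_of).1
    (inferInstance : CompleteSpace (Compl N))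

variable (N) in
/-- The constant functions. -/
def Pre.const (v : X) : Pre N := ⟨fun _ => v, isPre_const v⟩

theorem Pre.pnorm_const (v : X) : (const N v).pnorm = N.toFun v := pn_const v

variable (N) in
/-- The canonical map into the completion. -/
noncomputable def toComplMod : X →ₗ[ℝ] complMod N where
  toFun v := complMod.of N (Pre.const N v : Compl N)
  map_add' v v' := Completion.coe_add (Pre.const N v)
    (Pre.const N v')
  map_smul' r v := (algebraMap_smul_coe r (Pre.const N v)).symm

theorem toComplMod_apply (v : X) :
    toComplMod N v = complMod.of N (Pre.const N v : Compl N) := rfl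

theorem pnorm_toComplMod (v : X) : (complMod N).pnorm (toComplMod N v) = N.toFun v := by
  rw [toComplMod_apply, complMod.pnorm_of, Compl.pnorm_coe, Pre.pnorm_const]

/-- A locally constant function is the glueing of its local values, each regarded as a constant
function. -/
theorem of_mem_glue (f : Pre N) :
    complMod.of N (f : Compl N) ∈ (complMod N).glue (range (toComplMod N)) := by
  obtain ⟨x, v, hx, hv⟩ := IsPre.exists_rep f.2
  have hpn : ∀ n, x n • N.toFun (v n) = x n • f.pnorm := fun n => (IsPre.smul_pn f.2 hx hv n).symm
  refine ⟨x, fun n => toComplMod N (v n), hx, fun n => ⟨v n, rfl⟩,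
    NormMod.orderBounded_of_le (c := f.pnorm) fun n => ?_, fun n => ?_⟩
  · rw [NormMod.pnorm_smul_of_nonneg (hx.nonneg n), pnorm_toComplMod, hpn]
    exact smul_le_self_V (hx.idem n) f.pnorm_nonneg
  · refine sub_eq_zero.1 (((complMod N).pnorm_eq_zero _).1 ?_)
    dsimp only
    rw [← smul_sub, NormMod.pnorm_smul_of_nonneg (hx.nonneg n), toComplMod_apply,
      ← complMod.of_sub, complMod.pnorm_of, ← Completion.coe_sub, Compl.pnorm_coe]
    have h2 : x n • (f - Pre.const N (v n)).pnorm = x n • N.pn 0 :=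
      IsPre.smul_pn_congr (f - Pre.const N (v n)).2 isPre_zero
        (hx.idem n) fun b hb hbn => by
          change f.1 b - v n = 0
          rw [hv n b hb hbn, sub_self]
    rw [h2, pn_zero, smul_zero]

theorem dense_glue_toComplMod : Dense ((complMod N).glue (range (toComplMod N))) := by
  have h : DenseRange (complMod.of N ∘ ((↑) : Pre N → Compl N)) :=
    complMod.surjective_of.denseRange.comp Completion.denseRange_coe
      complMod.isometry_of.continuous
  refine Dense.mono ?_ h
  rintro _ ⟨f, rfl⟩
  exact of_mem_glue f

end VSeminorm

end Completion

/-! ### Pushforward -/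

section Push

variable {A : Type u₁} [CommRing A] [Algebra ℝ A] [Lattice A]
  {B : Type u₂} [CommRing B] [Algebra ℝ B] [Lattice B]
  {S₁ : MetricFStructure A} {S₂ : MetricFStructure B} (φ : MetricFStructureHom S₁ S₂)

namespace MetricFStructureHom

/-- Positivity is disjointness from zero, `v ⊓ 0 = 0`, which a Riesz homomorphism preserves. -/
theorem onV_nonneg {v : S₁.V} (hv : 0 ≤ v) : 0 ≤ φ.onV v := by
  have h := φ.isRieszHom (v : A) 0 (inf_eq_right.2 hv)
  rw [map_zero] at h
  exact (inf_eq_right.1 h : (0 : B) ≤ _)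

theorem onU_nonneg {x : S₁.U} (hx : 0 ≤ x) : 0 ≤ φ.onU x := by
  have h := φ.isRieszHom (x : A) 0 (inf_eq_right.2 hx)
  rw [map_zero] at h
  exact (inf_eq_right.1 h : (0 : B) ≤ _)

theorem onV_add (v v' : S₁.V) : φ.onV (v + v') = φ.onV v + φ.onV v' :=
  Subtype.ext (map_add φ.toAlgHom (v : A) v')

theorem onV_sub (v v' : S₁.V) : φ.onV (v - v') = φ.onV v - φ.onV v' :=
  Subtype.ext (map_sub φ.toAlgHom (v : A) v')

theorem onV_mono {v v' : S₁.V} (h : v ≤ v') : φ.onV v ≤ φ.onV v' := by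
  have := φ.onV_nonneg (sub_nonneg.2 h)
  rwa [onV_sub, sub_nonneg] at this

theorem onV_real_smul (r : ℝ) (v : S₁.V) : φ.onV (r • v) = r • φ.onV v :=
  Subtype.ext (map_smul φ.toAlgHom r (v : A))

theorem onV_smul (x : S₁.U) (v : S₁.V) : φ.onV (x • v) = φ.onU x • φ.onV v :=
  Subtype.ext (map_mul φ.toAlgHom (x : A) v)

/-- The seminorm `φ(|·|)` on a normed module. -/
def vSeminorm (M : NormMod.{u₁, w} S₁) : VSeminorm S₂ M where
  toFun v := φ.onV (M.pnorm v)
  nonneg v := φ.onV_nonneg (M.pnorm_nonneg v)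
  zero := by rw [M.pnorm_zero]; exact Subtype.ext (map_zero φ.toAlgHom)
  add_le v v' := by rw [← onV_add]; exact φ.onV_mono (M.pnorm_add_le v v')
  smul_eq r v := by rw [NormMod.pnorm_real_smul, onV_real_smul]

theorem exists_isPushforward (M : NormMod.{u₁, w} S₁) :
    ∃ (P : BanMod.{u₂, max u₂ w} S₂) (p : M →ₗ[ℝ] P.obj), IsPushforward φ M P p :=
  ⟨⟨VSeminorm.complMod (φ.vSeminorm M), VSeminorm.isBanach_complMod⟩,
    VSeminorm.toComplMod (φ.vSeminorm M), VSeminorm.pnorm_toComplMod,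
    VSeminorm.dense_glue_toComplMod⟩

end MetricFStructureHom

/-! ### Universal property of the pushforward -/

namespace IsPushforward

variable {φ}

/-- Extension of a map that is bounded with respect to the pointwise norm. -/
theorem exists_extension {M : NormMod.{u₁, w} S₁} {P : BanMod.{u₂, w'} S₂} {Q : BanMod.{u₂, w''} S₂}
    {p : M →ₗ[ℝ] P.obj} (hp : IsPushforward φ M P p) (t : M →ₗ[ℝ] Q.obj) {c : S₂.U} (hc0 : 0 ≤ c)
    (hc : ∀ v, Q.obj.pnorm (t v) ≤ c • φ.onV (M.pnorm v)) :
    ∃ T : P.obj →ₗ[S₂.U] Q.obj, (∀ v, T (p v) = t v) ∧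
      ∀ z, Q.obj.pnorm (T z) ≤ c • P.obj.pnorm z :=
  haveI : CompleteSpace Q.obj := Q.property
  NormMod.exists_extension hc0 (fun v => by rw [hp.pnorm_eq]; exact hc v) hp.dense

theorem hom_ext {M : NormMod.{u₁, w} S₁} {P : BanMod.{u₂, w'} S₂} {Q : NormMod.{u₂, w''} S₂}
    {p : M →ₗ[ℝ] P.obj} (hp : IsPushforward φ M P p) {T T' : P.obj →ₗ[S₂.U] Q}
    (hT : T ∈ NormMod.homs P.obj Q) (hT' : T' ∈ NormMod.homs P.obj Q)
    (h : ∀ v, T (p v) = T' (p v)) : T = T' :=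
  NormMod.eq_of_eqOn hT hT' hp.dense (by rintro _ ⟨v, rfl⟩; exact h v)

/-- Extend `q` over `P` and `p` over `Q` with bound `1`. Both composites fix the generators, hence
are identities, and two norm-decreasing inverse maps preserve the norm. -/
theorem existsUnique_equiv {M : NormMod.{u₁, w} S₁} {P : BanMod.{u₂, w'} S₂}
    {Q : BanMod.{u₂, w''} S₂} {p : M →ₗ[ℝ] P.obj} {q : M →ₗ[ℝ] Q.obj}
    (hp : IsPushforward φ M P p) (hq : IsPushforward φ M Q q) :
    ∃! Φ : P.obj ≃ₗ[S₂.U] Q.obj,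
      (∀ z, Q.obj.pnorm (Φ z) = P.obj.pnorm z) ∧ ∀ v, Φ (p v) = q v := by
  obtain ⟨F, hF, hF1⟩ := hp.exists_extension q one_nonneg' fun v => by
    rw [one_smul, hq.pnorm_eq]
  obtain ⟨G, hG, hG1⟩ := hq.exists_extension p one_nonneg' fun v => by
    rw [one_smul, hp.pnorm_eq]
  simp only [one_smul] at hF1 hG1
  have hGF : G.comp F = LinearMap.id := hp.hom_ext
    (NormMod.mem_homs_of_le _ fun z => (hG1 _).trans (hF1 z))
    (NormMod.mem_homs_of_le _ fun z => le_rfl) fun v => by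
      rw [LinearMap.comp_apply, hF, hG, LinearMap.id_apply]
  have hFG : F.comp G = LinearMap.id := hq.hom_ext
    (NormMod.mem_homs_of_le _ fun z => (hF1 _).trans (hG1 z))
    (NormMod.mem_homs_of_le _ fun z => le_rfl) fun v => by
      rw [LinearMap.comp_apply, hG, hF, LinearMap.id_apply]
  refine ⟨LinearEquiv.ofLinearMap F G hFG hGF, ⟨fun z => le_antisymm (hF1 z) ?_, hF⟩, ?_⟩
  · have h := hG1 (F z)
    rwa [← LinearMap.comp_apply, hGF] at h
  · rintro Ψ ⟨hΨ, hΨp⟩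
    refine LinearEquiv.toLinearMap_injective (hp.hom_ext
      (NormMod.mem_homs_of_le _ fun z => (hΨ z).le) (NormMod.mem_homs_of_le _ hF1) fun v => ?_)
    exact (hΨp v).trans (hF v).symm

end IsPushforward

/-- The infimum of the bounds of a homomorphism is a bound. -/
theorem isGLB_mem_bounds {M : NormMod.{u₁, w} S₁} {N : NormMod.{u₁, w'} S₁} {T : M →ₗ[S₁.U] N}
    (hT : T ∈ NormMod.homs M N) {a : S₁.U} (ha : IsGLB (NormMod.bounds T) a) :
    a ∈ NormMod.bounds T := by
  have := fAlgebra_ambient S₁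
  refine ⟨ha.2 fun b hb => hb.1, fun v => ?_⟩
  have hv0 := M.pnorm_nonneg v
  -- Here `D` consists of the differences `b - a`. Its positive lower bounds vanish because `a` is
  -- the infimum, and the excess of `|T v|` over `a |v|` is at most `(b - a) |v|` for every bound
  -- `b`.
  have key : ((N.pnorm (T v) - a • M.pnorm v : S₁.V) : A)⁺ ≤ 0 := by
    refine nonpos_of_forall_le_mul S₁.isMetric.localisable.sigmaComplete
      (D := (fun b : S₁.U => ((b - a : S₁.U) : A)) '' NormMod.bounds T) (w := (M.pnorm v : A))
      (posPart_nonneg _) hv0 ?_ ?_ ?_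
    · rintro _ ⟨b, hb, rfl⟩
      exact (sub_nonneg.2 (ha.1 hb) : 0 ≤ b - a)
    · intro e he hle
      obtain ⟨b₀, hb₀⟩ := hT
      -- The infimum is taken in `U`, so a lower bound from the ambient algebra has to be brought
      -- into `U`; it lies below `b₀ - a`, and `U` is solid.
      have heU : e ∈ S₁.U.toSubalgebra := S₁.isMetric.solidU e _ (b₀ - a).2 (by
        have h := hle _ ⟨b₀, hb₀, rfl⟩
        rwa [abs_of_nonneg he, abs_of_nonneg (he.trans h)])
      have h1 : (⟨e, heU⟩ : S₁.U) + a ≤ a := ha.2 fun b hb =>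
        le_sub_iff_add_le.1 (hle _ ⟨b, hb, rfl⟩ : (⟨e, heU⟩ : S₁.U) ≤ b - a)
      exact le_antisymm ((add_le_iff_nonpos_left (a := (⟨e, heU⟩ : S₁.U))).1 h1 : _ ≤ _) he
    · rintro _ ⟨b, hb, rfl⟩
      have h1 : N.pnorm (T v) - a • M.pnorm v ≤ (b - a) • M.pnorm v := by
        rw [sub_smul_V]; exact sub_le_sub_right (hb.2 v) _
      have h2 : (0 : S₁.V) ≤ (b - a) • M.pnorm v := smul_nonneg_V (sub_nonneg.2 (ha.1 hb)) hv0
      exact sup_le h1 h2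
  have h3 : N.pnorm (T v) - a • M.pnorm v ≤ 0 := le_trans (le_posPart _) key
  exact sub_nonpos.1 h3

/-- The estimate is `|q (T v)| = φ(|T v|) ≤ φ(c) φ(|v|)`. Recording the bound `φ(c)` for an
arbitrary `c` allows `c = |T|` later. -/
theorem exists_pushforward_hom {φ : MetricFStructureHom S₁ S₂} {M N : NormMod.{u₁, w} S₁}
    {P Q : BanMod.{u₂, w'} S₂} {p : M →ₗ[ℝ] P.obj} {q : N →ₗ[ℝ] Q.obj}
    (hp : IsPushforward φ M P p) (hq : IsPushforward φ N Q q) (T : M →ₗ[S₁.U] N) {c : S₁.U}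
    (hc : c ∈ NormMod.bounds T) :
    ∃ T' : P.obj →ₗ[S₂.U] Q.obj, (∀ v, T' (p v) = q (T v)) ∧ φ.onU c ∈ NormMod.bounds T' := by
  let T₀ : M →ₗ[ℝ] N :=
    { toFun := T, map_add' := T.map_add, map_smul' := fun r v => T.map_smul _ v }
  obtain ⟨T', h1, h2⟩ := hp.exists_extension
    (t := q.comp T₀) (φ.onU_nonneg hc.1) fun v => by
      rw [LinearMap.comp_apply, hq.pnorm_eq, ← φ.onV_smul]
      exact φ.onV_mono (hc.2 v)
  exact ⟨T', h1, φ.onU_nonneg hc.1, h2⟩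

theorem exists_pushforward_mor {φ : MetricFStructureHom S₁ S₂} {M N : NormMod.{u₁, w} S₁}
    {P Q : BanMod.{u₂, w'} S₂} {p : M →ₗ[ℝ] P.obj} {q : N →ₗ[ℝ] Q.obj}
    (hp : IsPushforward φ M P p) (hq : IsPushforward φ N Q q) (T : NormMod.Mor M N) :
    ∃ T' : NormMod.Mor P.obj Q.obj, ∀ v, T'.toLin (p v) = q (T.toLin v) := by
  obtain ⟨T', h1, h2⟩ := exists_pushforward_hom hp hq T.toLin (c := 1)
    ⟨one_nonneg', fun v => by rw [one_smul]; exact T.pnorm_le v⟩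
  have h3 : φ.onU 1 = 1 := Subtype.ext (map_one φ.toAlgHom)
  have h4 : ∀ z, Q.obj.pnorm (T' z) ≤ P.obj.pnorm z := fun z => by
    have := h2.2 z
    rwa [h3, one_smul] at this
  exact ⟨⟨T', NormMod.mem_homs_of_le _ h4, h4⟩, h1⟩

/-- Identities and composites are respected because two morphisms out of a pushforward agree once
they agree on the image of the module. -/
theorem exists_pushforward_functor (φ : MetricFStructureHom S₁ S₂) :
    ∃ (F : BanMod.{u₁, w} S₁ ⥤ BanMod.{u₂, max u₂ w} S₂)
      (η : ∀ M : BanMod.{u₁, w} S₁, M.obj →ₗ[ℝ] (F.obj M).obj),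
      (∀ M, IsPushforward φ M.obj (F.obj M) (η M)) ∧
      ∀ (M N : BanMod.{u₁, w} S₁) (T : M ⟶ N) (v : M.obj),
        (F.map T).hom.toLin (η M v) = η N (T.hom.toLin v) := by
  choose P p hP using fun M : BanMod.{u₁, w} S₁ => φ.exists_isPushforward M.obj
  choose f hf using fun (M N : BanMod.{u₁, w} S₁) (T : M ⟶ N) =>
    exists_pushforward_mor (hP M) (hP N) T.hom
  have hext : ∀ {M N : BanMod.{u₁, w} S₁} (T T' : NormMod.Mor (P M).obj (P N).obj),
      (∀ v, T.toLin (p M v) = T'.toLin (p M v)) → T = T' := fun {M N} T T' h =>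
    NormMod.Mor.ext ((hP M).hom_ext T.mem_homs T'.mem_homs h)
  refine ⟨{ obj := P, map := fun {M N} T => ObjectProperty.homMk (f M N T), map_id := fun M => ?_,
            map_comp := fun {L M N} T T' => ?_ }, p, hP, hf⟩
  · refine ObjectProperty.hom_ext _ (hext _ _ fun v => ?_)
    exact hf M M (𝟙 M) v
  · refine ObjectProperty.hom_ext _ (hext _ _ fun v => ?_)
    refine (hf L N (T ≫ T') v).trans ?_
    have h1 := hf L M T v
    have h2 := hf M N T' (T.hom.toLin v)
    rw [← h1] at h2
    exact h2.symm

end Push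

end FMod

theorem mainTheorem6
    {A : Type u₁} [CommRing A] [Algebra ℝ A] [Lattice A]
    {B : Type u₂} [CommRing B] [Algebra ℝ B] [Lattice B]
    (S₁ : MetricFStructure A) (S₂ : MetricFStructure B) (φ : MetricFStructureHom S₁ S₂) :
    -- existence of the pushforward, and uniqueness up to unique isomorphism
    (∀ M : NormMod.{u₁, w} S₁,
      ∃ (P : BanMod.{u₂, max u₂ w} S₂) (p : M →ₗ[ℝ] P.obj), IsPushforward φ M P p ∧
        ∀ (N : BanMod.{u₂, w'} S₂) (T : M →ₗ[ℝ] N.obj), IsPushforward φ M N T →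
          ∃! Φ : P.obj ≃ₗ[S₂.U] N.obj,
            (∀ z, N.obj.pnorm (Φ z) = P.obj.pnorm z) ∧ ∀ v, Φ (p v) = T v) ∧
    -- homomorphisms have a unique pushforward
    (∀ (M N : NormMod.{u₁, w} S₁) (P Q : BanMod.{u₂, w'} S₂)
      (p : M →ₗ[ℝ] P.obj) (q : N →ₗ[ℝ] Q.obj),
      IsPushforward φ M P p → IsPushforward φ N Q q →
      ∀ T ∈ NormMod.homs M N,
        ∃ T' ∈ NormMod.homs P.obj Q.obj, (∀ v, T' (p v) = q (T v)) ∧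
          (∀ T'' ∈ NormMod.homs P.obj Q.obj, (∀ v, T'' (p v) = q (T v)) → T'' = T') ∧
          (DedekindComplete S₁.U → DedekindComplete S₂.U →
            ∃ (a : S₁.U) (b : S₂.U), IsGLB (NormMod.bounds T) a ∧ IsGLB (NormMod.bounds T') b ∧
              b ≤ φ.onU a)) ∧
    -- the induced functor between the categories of Banach modules
    (∃ (F : BanMod.{u₁, w} S₁ ⥤ BanMod.{u₂, max u₂ w} S₂)
      (η : ∀ M : BanMod.{u₁, w} S₁, M.obj →ₗ[ℝ] (F.obj M).obj),
      (∀ M, IsPushforward φ M.obj (F.obj M) (η M)) ∧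
      ∀ (M N : BanMod.{u₁, w} S₁) (T : M ⟶ N) (v : M.obj),
        (F.map T).hom.toLin (η M v) = η N (T.hom.toLin v)) := by
  refine ⟨fun M => ?_, fun M N P Q p q hp hq T hT => ?_, exists_pushforward_functor φ⟩
  · obtain ⟨P, p, hp⟩ := φ.exists_isPushforward M
    exact ⟨P, p, hp, fun N T hT => hp.existsUnique_equiv hT⟩
  · obtain ⟨c, hc⟩ := id hT
    obtain ⟨T', hT', hb⟩ := exists_pushforward_hom hp hq T hc
    refine ⟨T', ⟨_, hb⟩, hT', fun T'' hT'' h => hp.hom_ext hT'' ⟨_, hb⟩ fun v => ?_,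
      fun h₁ h₂ => ?_⟩
    · rw [h, hT']
    · obtain ⟨a, ha⟩ := h₁.2 (NormMod.bounds T) hT ⟨0, fun b hb => hb.1⟩
      obtain ⟨b, hb'⟩ := h₂.2 (NormMod.bounds T') ⟨_, hb⟩ ⟨0, fun b hb => hb.1⟩
      -- `T'` was built from an arbitrary bound `c`. Building it again from the infimum `a` gives
      -- the same map by uniqueness, so `φ(a)` is a bound of `T'`.
      obtain ⟨T₂, hT₂, hb₂⟩ := exists_pushforward_hom hp hq T (isGLB_mem_bounds hT ha)
      have e : T₂ = T' := hp.hom_ext ⟨_, hb₂⟩ ⟨_, hb⟩ fun v => by rw [hT₂, hT']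
      exact ⟨a, b, ha, hb', hb'.1 (e ▸ hb₂)⟩
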